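/- **Theorem 4.** *Protocol.* Let $G$ be a finite simple graph and $k$ an odd positive integer. For a vertex $v$ of degree $d(v)$ let $k(v)=\min\{k,\,2\lfloor (d(v)-1)/2\rfloor+1\}$. At every time $t=0,1,2,\dots$ each vertex is either red or blue. In the $k$-choice majority protocol $\mathcal{MP}^k$ on $G$, at each time step $t+1$ each vertex $v$ picks a uniformly random $k(v)$-element subset $N_v(t+1)$ of its neighbours and takes, at time $t+1$, the majority colour at time $t$ of the vertices in $N_v(t+1)$ (a vertex without neighbours keeps its colour). At time $0$ each vertex is red with probability $\alpha$ and blue otherwise. Given $G$, the initial colours and all the sets $N_v(t)$ are independent. *Statement.* Let $\epsilon>0$ and $\varepsilon>0$ be constants, let $d\ge 5$ be an odd constant, put $\nu=\frac{d-1}{2}$, and let $\alpha\in(0,\tfrac12)$ and $\beta<1$ be constants such that $$\left[2\left(1+\frac{1}{\sqrt{2\nu}}\right)\right]^{\frac{1}{\nu-1}}4\alpha(1-\alpha)<\beta .$$ Let $$A=\frac{1+\varepsilon}{\log_d(d-1)-\log_d 2}.$$ Then there are $\gamma>0$ and $n_0$, depending only on $\epsilon,\varepsilon,d,\alpha,\beta$,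 such that the following holds for all $n\ge n_0$ and all real $c>2+\epsilon$ (possibly depending on $n$) for which $p=\frac{c\log n}{n}\le 1$. Draw $G$ from the Erdős–Rényi model $\mathcal G(n,p)$ and then run $\mathcal{MP}^d$ on $G$. With probability at least $1-n^{-\gamma}$ (over the graph, the initial colours and the polling choices), there is an integer time $t\le A\log_d\log_d n$ at which all vertices have the same colour, namely the colour held by more than half of the vertices at time $0$. -/

import Mathlib

open MeasureTheory ProbabilityTheory unitInterval

namespace MajorityPolling

/-- `pollSize k m` is the number of neighbours polled by a vertex of degree `m` when the parameter
of the protocol is the odd number `k`: `min {k, 2⌊(m-1)/2⌋+1}`, that is, the smaller of `k` and the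
largest odd integer not exceeding `m`. Integer division by `2` is the floor here, and the value is
`0` for an isolated vertex. -/
def pollSize (k m : ℕ) : ℕ :=
  (min (k : ℤ) (2 * (((m : ℤ) - 1) / 2) + 1)).toNat

theorem pollSize_le (k m : ℕ) : pollSize k m ≤ m := by
  unfold pollSize
  omega

section Protocol

variable {V : Type} [Fintype V]

open Classical in
/-- The sets that the vertex `v` may poll: the `k(v)`-element sets of neighbours of `v`. -/
noncomputable def polls (G : SimpleGraph V) (k : ℕ) (v : V) : Finset (Finset V) :=
  (G.neighborFinset v).powersetCard (pollSize k (G.degree v))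

theorem polls_nonempty (G : SimpleGraph V) (k : ℕ) (v : V) : (polls G k v).Nonempty :=
  Finset.powersetCard_nonempty.2 (pollSize_le k _)

/-- The uniform distribution on the sets that `v` may poll. -/
noncomputable def pollLaw (G : SimpleGraph V) (k : ℕ) (v : V) : Measure (Finset V) :=
  (PMF.uniformOfFinset (polls G k v) (polls_nonempty G k v)).toMeasure

instance (G : SimpleGraph V) (k : ℕ) (v : V) : IsProbabilityMeasure (pollLaw G k v) := by
  unfold pollLaw
  infer_instance

/-- A colouring of the vertices: `true` is blue and `false` is red. -/
abbrev Colouring (V : Type) : Type := V → Bool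

/-- The polling choices made during a run: the entry at `(t, v)` is the set that `v` polls
at time `t + 1`. -/
abbrev Choices (V : Type) : Type := ℕ × V → Finset V

/-- The randomness of a run of the `k`-choice majority protocol on the graph `G`: initially each
vertex is red with probability `α` and blue with probability `1 - α`, each vertex at each time step
polls a uniformly random `k(v)`-subset of its neighbours, and all of these are independent. -/
noncomputable def runLaw (G : SimpleGraph V) (k : ℕ) (α : I) :
    Measure (Colouring V × Choices V) :=
  (Measure.pi fun _ : V => bernoulliMeasure false true α).prod
    (Measure.infinitePi fun i : ℕ × V => pollLaw G k i.2)

open Classical in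
/-- The colouring at time `t` of the `k`-choice majority protocol on `G` with initial colouring `x₀`
and polling choices `N`. At time `t + 1` a vertex is blue iff more than `k(v)/2` of the vertices
which it polls are blue at time `t`. A vertex without neighbours has nobody to poll and keeps its
colour. -/
noncomputable def run (G : SimpleGraph V) (k : ℕ) (x₀ : Colouring V) (N : Choices V) :
    ℕ → Colouring V
  | 0 => x₀
  | t + 1 => fun v =>
      if G.degree v = 0 then run G k x₀ N t v
      else decide
        (pollSize k (G.degree v) < 2 * ((N (t, v)).filter fun w => run G k x₀ N t w = true).card)

/-- `b` is the colour of more than half of the vertices. -/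
def IsMajority (x : Colouring V) (b : Bool) : Prop :=
  Fintype.card V < 2 * (Finset.univ.filter fun v => x v = b).card

/-- The event that at some (integer) time `t ≤ T` all vertices have the colour that was the
majority colour at time `0`. The sample point consists of the graph, the initial colouring and the
polling choices. -/
def majorityConsensusBy (k : ℕ) (T : ℝ) : Set (SimpleGraph V × Colouring V × Choices V) :=
  {ω | ∃ b : Bool, IsMajority ω.2.1 b ∧
    ∃ t : ℕ, (t : ℝ) ≤ T ∧ ∀ v, run ω.1 k ω.2.1 ω.2.2 t v = b}

instance : MeasurableSingletonClass (SimpleGraph V) where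
  measurableSet_singleton G := by
    have h := SimpleGraph.measurable_edgeSet (V := V) (measurableSet_singleton G.edgeSet)
    have e : SimpleGraph.edgeSet ⁻¹' {G.edgeSet} = ({G} : Set (SimpleGraph V)) := by
      ext H
      simp
    rwa [e] at h

end Protocol

/-- The law of the whole trial: first a graph is drawn from the binomial random graph model
`𝒢(n, p)`, then the `k`-choice majority protocol is run on it. -/
noncomputable def trialLaw (n k : ℕ) (p α : I) :
    Measure (SimpleGraph (Fin n) × Colouring (Fin n) × Choices (Fin n)) :=
  (SimpleGraph.binomialRandom (Fin n) p).compProd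
    (Kernel.ofFunOfCountable fun G => runLaw G k α)

end MajorityPolling

/-! Put `ν = (d - 1) / 2`. If `v` is red at time `t + 1`, then at least `ν + 1` of its `2ν + 1`
polled vertices were red at time `t`. Trace each such polled vertex `u` back to time `0` along its
polling tree, pessimistically counting the parent as red whenever it is polled (`treeRed`). A vertex
of this tree then has `2ν` children and is red iff at least `ν` of them are.

If the sets of leaves of sibling subtrees are disjoint throughout a branch (`IsGood`), then, with
the polls fixed, the subtrees are independent, and the branch is red with probability exactly the
`t`-th iterate of the map `p ↦ P(Bin(2ν, p) ≥ ν)` at `α` (`colourLaw_real_treeRed`). Under the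
hypothesis on `β` this iterate is at most `β ^ ν ^ t` (`iterate_binomialTail_le`), hence at most
`n⁻²` for a `t` of order `log_ν log n`, and a union bound over all vertices and branches applies.

A branch that is not good contains two distinct non-backtracking walks of equal length with a common
end, that is, a cycle. Three such branches at one vertex force a connected graph of polled edges
with more edges than vertices (`IsWitness.card_add_one_le`). A prescribed edge is present with
probability `p` and polled with probability `O(1/(np))`, so each distinct edge costs `O(1/n)`,
whatever `p` is. Since there is one edge more than there are vertices, the expected number of such
configurations is `n⁻¹` times a factor which is at most `√n` for walks of length `O(log log n)`
(`trialLaw_real_isWitness_le`, `eventually_pow_le_sqrt`). So outside a small event every vertex has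
at most two bad branches, and `ν + 1 ≥ 3` red ones must include a good one.

The other failures are an initial colouring without blue majority and a vertex of small degree; the
latter is where `c > 2` gives a comfortable Chernoff bound. -/

namespace MajorityPolling

/-! ### Non-backtracking walks in graphs with few cycles -/

section NonBacktracking

variable {W : Type*}

/-- The sequence `a 0, …, a m` is a walk of length `m` in `U` that never steps back along the edge
which it has just used. -/
structure IsNonBacktracking (U : SimpleGraph W) (m : ℕ) (a : ℕ → W) : Prop where
  adj : ∀ j < m, U.Adj (a j) (a (j + 1))
  ne : ∀ j, j + 1 < m → a (j + 2) ≠ a j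

theorem exists_walk_of_adj {U : SimpleGraph W} {m : ℕ} {a : ℕ → W}
    (h : ∀ j < m, U.Adj (a j) (a (j + 1))) :
    ∃ p : U.Walk (a 0) (a m), p.support = (List.range (m + 1)).map a ∧
      p.edges = (List.range m).map fun j => s(a j, a (j + 1)) := by
  induction m generalizing a with
  | zero => exact ⟨.nil, by simp, by simp⟩
  | succ m ih =>
    obtain ⟨p, hp, hp'⟩ := ih (a := fun j => a (j + 1)) fun j hj => h (j + 1) (by lia)
    refine ⟨.cons (h 0 (by lia)) p, ?_, ?_⟩
    · rw [SimpleGraph.Walk.support_cons, hp, List.range_succ_eq_map (n := m + 1)]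
      simp [Function.comp_def]
    · rw [SimpleGraph.Walk.edges_cons, hp', List.range_succ_eq_map (n := m)]
      simp [Function.comp_def]

theorem IsNonBacktracking.exists_isPath {U : SimpleGraph W} (hU : U.IsAcyclic) {m : ℕ} {a : ℕ → W}
    (h : IsNonBacktracking U m a) :
    ∃ p : U.Walk (a 0) (a m), p.IsPath ∧ p.support = (List.range (m + 1)).map a := by
  obtain ⟨p, hp, hp'⟩ := exists_walk_of_adj h.adj
  -- In a forest a walk is a path as soon as consecutive edges differ. Equal ones would mean a loop
  -- or a step back.
  refine ⟨p, (hU.isPath_iff_isChain p).2 ?_, hp⟩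
  rw [hp', List.isChain_iff_getElem]
  intro j hj
  simp only [List.length_map, List.length_range] at hj
  simp only [List.getElem_map, List.getElem_range, ne_eq, Sym2.eq_iff, not_or, not_and]
  exact ⟨fun e => absurd e (h.adj j (by lia)).ne, fun e => absurd e.symm (h.ne j hj)⟩

/-- In a forest a non-backtracking walk is determined by its ends. -/
theorem IsNonBacktracking.unique {U : SimpleGraph W} (hU : U.IsAcyclic) {m k : ℕ} {a b : ℕ → W}
    (ha : IsNonBacktracking U m a) (hb : IsNonBacktracking U k b) (h₀ : a 0 = b 0)
    (h₁ : a m = b k) : m = k ∧ ∀ j ≤ m, a j = b j := by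
  obtain ⟨p, hp, hps⟩ := ha.exists_isPath hU
  obtain ⟨q, hq, hqs⟩ := hb.exists_isPath hU
  have key : ∀ {x y x' y' : W} (p : U.Walk x y) (q : U.Walk x' y'), p.IsPath → q.IsPath →
      x = x' → y = y' → p.support = q.support := by
    rintro x y _ _ p q hp hq rfl rfl
    exact congrArg (fun r : U.Path x y => r.1.support)
      ((hU.subsingleton_path x y).elim ⟨p, hp⟩ ⟨q, hq⟩)
  have e := key p q hp hq h₀ h₁
  rw [hps, hqs] at e
  have hm : m = k := by simpa using congrArg List.length e
  subst hm
  refine ⟨rfl, fun j hj => ?_⟩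
  have := congrArg (fun l : List W => l[j]?) e
  simpa [List.getElem?_map, List.getElem?_range (show j < m + 1 by lia)] using this

theorem IsNonBacktracking.of_forall_ne {U : SimpleGraph W} {e : Sym2 W} {m k : ℕ} {a : ℕ → W}
    (h : IsNonBacktracking U m a) (hk : k ≤ m) (he : ∀ j < k, s(a j, a (j + 1)) ≠ e) :
    IsNonBacktracking (U.deleteEdges {e}) k a where
  adj j hj := by
    rw [SimpleGraph.deleteEdges_adj]
    exact ⟨h.adj j (by lia), by simpa using he j hj⟩
  ne j hj := h.ne j (by lia)

/-- Two distinct non-backtracking walks with the same ends cannot both avoid an edge whose removal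
leaves a forest. -/
theorem exists_step_eq {U : SimpleGraph W} {e : Sym2 W} (hU : (U.deleteEdges {e}).IsAcyclic)
    {m : ℕ} {a b : ℕ → W} (ha : IsNonBacktracking U m a) (hb : IsNonBacktracking U m b)
    (h₀ : a 0 = b 0) (h₁ : a m = b m) (hne : ∃ j ≤ m, a j ≠ b j) :
    ∃ c : ℕ → W, (c = a ∨ c = b) ∧ ∃ k < m, s(c k, c (k + 1)) = e ∧
      IsNonBacktracking (U.deleteEdges {e}) k c := by
  classical
  by_contra! hcon
  have key : ∀ c : ℕ → W, (c = a ∨ c = b) → IsNonBacktracking U m c →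
      IsNonBacktracking (U.deleteEdges {e}) m c := by
    intro c hc hcU
    refine hcU.of_forall_ne le_rfl ?_
    by_contra! hex
    -- Taking the first use of `e` makes the prefix before it a walk in the forest.
    obtain ⟨hk, hke⟩ := Nat.find_spec hex
    refine hcon c hc _ hk hke (hcU.of_forall_ne hk.le fun j hj => ?_)
    have := Nat.find_min hex hj
    push Not at this
    exact this (by lia)
  obtain ⟨j, hj, hjne⟩ := hne
  exact hjne (((key a (.inl rfl) ha).unique hU (key b (.inr rfl) hb) h₀ h₁).2 j hj)

/-- In each branch one of the two walks must reach `e`, by a prefix inside the forest. Prefixes from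
`v` with different first steps end at different vertices, so three branches would reach three
distinct ends of the single edge `e`. -/
theorem false_of_deleteEdges_isAcyclic {U : SimpleGraph W} {e : Sym2 W}
    (hU : (U.deleteEdges {e}).IsAcyclic) {m : ℕ} {v : W} {x : Fin 3 → W}
    (hx : Function.Injective x) {a b : Fin 3 → ℕ → W}
    (ha : ∀ i, IsNonBacktracking U m (a i)) (hb : ∀ i, IsNonBacktracking U m (b i))
    (ha₀ : ∀ i, a i 0 = v) (hb₀ : ∀ i, b i 0 = v) (ha₁ : ∀ i, a i 1 = x i) (hb₁ : ∀ i, b i 1 = x i)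
    (hm : ∀ i, a i m = b i m) (hne : ∀ i, ∃ j ≤ m, a i j ≠ b i j) : False := by
  have step := fun i => exists_step_eq hU (ha i) (hb i) ((ha₀ i).trans (hb₀ i).symm) (hm i) (hne i)
  choose c hc k hk hke hkU using step
  have hc₀ : ∀ i, c i 0 = v := fun i => by rcases hc i with h | h <;> rw [h] <;> simp [ha₀, hb₀]
  have hc₁ : ∀ i, c i 1 = x i := fun i => by rcases hc i with h | h <;> rw [h] <;> simp [ha₁, hb₁]
  have main : ∀ i j, i ≠ j → c i (k i) ≠ c j (k j) := by
    intro i j hij h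
    obtain ⟨hkk, heq⟩ := (hkU i).unique hU (hkU j) ((hc₀ i).trans (hc₀ j).symm) h
    apply hij
    apply hx
    rw [← hc₁ i, ← hc₁ j]
    -- An empty prefix says nothing about the first step, but then `e` is itself the first edge of
    -- both walks, and its other end is `x i = x j`.
    rcases Nat.eq_zero_or_pos (k i) with h0 | h0
    · have e1 := (hke i).trans (hke j).symm
      rw [← hkk, h0] at e1
      simp only [hc₀, Nat.zero_add] at e1
      exact Sym2.congr_right.1 e1
    · exact heq 1 h0
  induction e with
  | h y z =>
    have hyz : ∀ i, c i (k i) = y ∨ c i (k i) = z := fun i => by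
      rcases Sym2.eq_iff.1 (hke i) with h | h
      · exact .inl h.1
      · exact .inr h.1
    have h01 := main 0 1 (by decide)
    have h02 := main 0 2 (by decide)
    have h12 := main 1 2 (by decide)
    rcases hyz 0 with h | h <;> rcases hyz 1 with h' | h' <;> rcases hyz 2 with h'' | h'' <;>
      simp_all

/-- A connected graph with at most as many edges as vertices becomes a forest on the removal of some
edge. -/
theorem exists_deleteEdges_isAcyclic [Fintype W] {U : SimpleGraph W} (hU : U.Connected)
    (hcard : Nat.card U.edgeSet ≤ Fintype.card W) : ∃ e, (U.deleteEdges {e}).IsAcyclic := by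
  classical
  obtain ⟨T, hTU, hT⟩ := hU.exists_isTree_le
  have hTc := hT.card_edgeFinset
  have hsub : T.edgeFinset ⊆ U.edgeFinset := SimpleGraph.edgeFinset_mono hTU
  have hUc : U.edgeFinset.card ≤ Fintype.card W := by
    rwa [Nat.card_eq_fintype_card, ← SimpleGraph.edgeFinset_card] at hcard
  have h1 : (U.edgeFinset \ T.edgeFinset).card ≤ 1 := by
    rw [Finset.card_sdiff_of_subset hsub]; lia
  have : Nonempty (Sym2 W) := hU.nonempty.map fun y => s(y, y)
  obtain ⟨e, he⟩ : ∃ e : Sym2 W, U.edgeFinset \ T.edgeFinset ⊆ {e} := by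
    rcases Finset.card_le_one_iff_subset_singleton.1 h1 with ⟨e, he⟩
    exact ⟨e, he⟩
  refine ⟨e, hT.isAcyclic.anti fun y z hyz => ?_⟩
  rw [SimpleGraph.deleteEdges_adj] at hyz
  by_contra hn
  have := he (Finset.mem_sdiff.2
    ⟨SimpleGraph.mem_edgeFinset.2 (SimpleGraph.mem_edgeSet _ |>.2 hyz.1),
    fun h => hn (SimpleGraph.mem_edgeSet _ |>.1 (SimpleGraph.mem_edgeFinset.1 h))⟩)
  exact hyz.2 (by simpa using this)

/-- If three branches at `v` each contain two distinct non-backtracking walks of the same length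
with a common end, then the graph has at least two independent cycles. -/
theorem card_add_one_le_card_edgeSet [Fintype W] {U : SimpleGraph W} (hU : U.Connected) {m : ℕ}
    {v : W} {x : Fin 3 → W} (hx : Function.Injective x) {a b : Fin 3 → ℕ → W}
    (ha : ∀ i, IsNonBacktracking U m (a i)) (hb : ∀ i, IsNonBacktracking U m (b i))
    (ha₀ : ∀ i, a i 0 = v) (hb₀ : ∀ i, b i 0 = v) (ha₁ : ∀ i, a i 1 = x i) (hb₁ : ∀ i, b i 1 = x i)
    (hm : ∀ i, a i m = b i m) (hne : ∀ i, ∃ j ≤ m, a i j ≠ b i j) :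
    Fintype.card W + 1 ≤ Nat.card U.edgeSet := by
  by_contra! h
  obtain ⟨e, he⟩ := exists_deleteEdges_isAcyclic hU (by lia)
  exact false_of_deleteEdges_isAcyclic he hx ha hb ha₀ hb₀ ha₁ hb₁ hm hne

end NonBacktracking

/-! ### Witnesses: three cyclic branches at one vertex -/

section Witness

variable {V : Type}

/-- Six non-backtracking walks of length `m` from `v`, two in each of three branches at `v`; the two
walks in the same branch are distinct and have the same end. -/
structure IsWitness (v : V) (m : ℕ) (w : Fin 3 × Bool → ℕ → V) : Prop where
  start : ∀ i, w i 0 = v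
  branch : ∀ i, w (i, true) 1 = w (i, false) 1
  injective : Function.Injective fun i => w (i, true) 1
  finish : ∀ i, w (i, true) m = w (i, false) m
  distinct : ∀ i, ∃ j ≤ m, w (i, true) j ≠ w (i, false) j
  step : ∀ i, ∀ j < m, w i j ≠ w i (j + 1)
  ne : ∀ i j, j + 1 < m → w i (j + 2) ≠ w i j

variable [DecidableEq V]

/-- The vertices visited by a family of walks. -/
def walkVertices (m : ℕ) (w : Fin 3 × Bool → ℕ → V) : Finset V :=
  (Finset.univ ×ˢ Finset.range (m + 1)).image fun q => w q.1 q.2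

/-- The edges used by a family of walks. -/
def walkEdges (m : ℕ) (w : Fin 3 × Bool → ℕ → V) : Finset (Sym2 V) :=
  (Finset.univ ×ˢ Finset.range m).image fun q => s(w q.1 q.2, w q.1 (q.2 + 1))

theorem mem_walkVertices {m : ℕ} {w : Fin 3 × Bool → ℕ → V} {i : Fin 3 × Bool} {j : ℕ}
    (hj : j ≤ m) : w i j ∈ walkVertices m w :=
  Finset.mem_image.2 ⟨(i, j), by simp; lia, rfl⟩

theorem mem_walkEdges {m : ℕ} {w : Fin 3 × Bool → ℕ → V} {i : Fin 3 × Bool} {j : ℕ}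
    (hj : j < m) : s(w i j, w i (j + 1)) ∈ walkEdges m w :=
  Finset.mem_image.2 ⟨(i, j), by simpa using hj, rfl⟩

/-- The visited vertices and used edges form a graph that is connected through `v`, and three
branches with a cycle each cannot be cut down to a forest by removing one edge. The surplus edge is
what makes witnesses rare. -/
theorem IsWitness.card_add_one_le {v : V} {m : ℕ} {w : Fin 3 × Bool → ℕ → V}
    (h : IsWitness v m w) : (walkVertices m w).card + 1 ≤ (walkEdges m w).card := by
  classical
  let U : SimpleGraph (walkVertices m w) :=
    (SimpleGraph.fromEdgeSet (walkEdges m w : Set (Sym2 V))).comap Subtype.val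
  let a : Fin 3 × Bool → ℕ → walkVertices m w := fun i j =>
    ⟨w i (min j m), mem_walkVertices (min_le_right j m)⟩
  have ha : ∀ i, ∀ j ≤ m, (a i j : V) = w i j := fun i j hj => by simp [a, min_eq_left hj]
  have hadj : ∀ i, ∀ j < m, U.Adj (a i j) (a i (j + 1)) := fun i j hj => by
    simp only [U, SimpleGraph.comap_adj, SimpleGraph.fromEdgeSet_adj, ha i j hj.le,
      ha i (j + 1) hj]
    exact ⟨mem_walkEdges hj, h.step i j hj⟩
  have hnb : ∀ i, IsNonBacktracking U m (a i) := fun i => ⟨hadj i, fun j hj e => by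
    have := congrArg Subtype.val e
    rw [ha i _ (by lia), ha i _ (by lia)] at this
    exact h.ne i j hj this⟩
  have hpos : 1 ≤ m := by
    by_contra! hm
    obtain ⟨j, hj, hne⟩ := h.distinct 0
    obtain rfl : j = 0 := by lia
    exact hne (by rw [h.start, h.start])
  let r : walkVertices m w := a (0, true) 0
  have ha₀ : ∀ i, a i 0 = r := fun i => Subtype.ext (by
    rw [ha _ _ (Nat.zero_le m), ha _ _ (Nat.zero_le m), h.start, h.start])
  have hreach : ∀ i, ∀ j ≤ m, U.Reachable r (a i j) := by
    intro i j hj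
    induction j with
    | zero => rw [ha₀]
    | succ j ih => exact (ih (by lia)).trans (hadj i j (by lia)).reachable
  have hconn : U.Connected := by
    rw [SimpleGraph.connected_iff_exists_forall_reachable]
    refine ⟨r, fun y => ?_⟩
    obtain ⟨q, hq, hqy⟩ := Finset.mem_image.1 y.2
    have hq2 : q.2 ≤ m := by simp at hq; lia
    have : y = a q.1 q.2 := Subtype.ext (by rw [ha _ _ hq2, hqy])
    rw [this]
    exact hreach _ _ hq2
  have key := card_add_one_le_card_edgeSet hconn (m := m) (v := r)
    (x := fun i => a (i, true) 1) (a := fun i => a (i, true)) (b := fun i => a (i, false))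
    (fun i j hij => h.injective (by
      have := congrArg Subtype.val hij
      simpa only [ha _ 1 hpos] using this))
    (fun i => hnb _) (fun i => hnb _) (fun i => ha₀ _) (fun i => ha₀ _) (fun i => rfl)
    (fun i => Subtype.ext (by rw [ha _ 1 hpos, ha _ 1 hpos, h.branch]))
    (fun i => Subtype.ext (by rw [ha _ m le_rfl, ha _ m le_rfl, h.finish]))
    (fun i => by
      obtain ⟨j, hj, hne⟩ := h.distinct i
      exact ⟨j, hj, fun e => hne (by rw [← ha _ j hj, ← ha _ j hj, e])⟩)
  rw [Fintype.card_coe] at key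
  refine key.trans ?_
  have hmap : ∀ e ∈ U.edgeSet, Sym2.map Subtype.val e ∈ walkEdges m w := by
    intro e he
    induction e with
    | h y z =>
      rw [SimpleGraph.mem_edgeSet, SimpleGraph.comap_adj, SimpleGraph.fromEdgeSet_adj] at he
      exact he.1
  have := Nat.card_le_card_of_injective
    (fun e : U.edgeSet => (⟨Sym2.map Subtype.val e.1, hmap e.1 e.2⟩ : walkEdges m w))
    fun e f hef => Subtype.ext (Sym2.map.injective Subtype.val_injective (congrArg Subtype.val hef))
  rwa [Nat.card_eq_fintype_card (α := walkEdges m w), Fintype.card_coe] at this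

end Witness

/-! ### The polling tree and its pessimistic colouring -/

section TreeProcess

variable {V : Type}

open Classical in
/-- A set of `2 * ν` of the vertices other than `w` which `u` polls at time `s + 1`, if there are
that many. -/
noncomputable def children (N : Choices V) (ν s : ℕ) (w u : V) : Finset V :=
  if h : 2 * ν ≤ ((N (s, u)).erase w).card then (Finset.exists_subset_card_eq h).choose else ∅

open Classical in
theorem children_subset (N : Choices V) (ν s : ℕ) (w u : V) :
    children N ν s w u ⊆ (N (s, u)).erase w := by
  unfold children
  split_ifs with h
  · exact (Finset.exists_subset_card_eq h).choose_spec.1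
  · exact Finset.empty_subset _

theorem mem_of_mem_children {N : Choices V} {ν s : ℕ} {w u y : V} (h : y ∈ children N ν s w u) :
    y ∈ N (s, u) ∧ y ≠ w := by
  classical
  have := children_subset N ν s w u h
  rw [Finset.mem_erase] at this
  exact this.symm

theorem card_children {N : Choices V} {ν s : ℕ} {w u : V} (h : (N (s, u)).card = 2 * ν + 1) :
    (children N ν s w u).card = 2 * ν := by
  classical
  have h' : 2 * ν ≤ ((N (s, u)).erase w).card := by
    have := Finset.pred_card_le_card_erase (a := w) (s := N (s, u))
    lia
  unfold children
  rw [dif_pos h']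
  exact (Finset.exists_subset_card_eq h').choose_spec.2

open Classical in
/-- A pessimistic version of the event that `u` is red at time `s`, in which `w` counts as red
whenever `u` polls it, and recursively. -/
noncomputable def treeRed (N : Choices V) (ν : ℕ) : ℕ → V → V → Colouring V → Prop
  | 0, _, u, x => x u = false
  | s + 1, w, u, x => ν ≤ ((children N ν s w u).filter fun y => treeRed N ν s u y x).card

open Classical in
/-- The vertices whose initial colours determine `treeRed N ν s w u`. -/
noncomputable def leaves (N : Choices V) (ν : ℕ) : ℕ → V → V → Finset V
  | 0, _, u => {u}
  | s + 1, w, u => (children N ν s w u).biUnion fun y => leaves N ν s u y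

/-- The branches of the polling tree behind `u` have disjoint sets of leaves, and recursively. -/
def IsGood (N : Choices V) (ν : ℕ) : ℕ → V → V → Prop
  | 0, _, _ => True
  | s + 1, w, u => (children N ν s w u : Set V).PairwiseDisjoint (fun y => leaves N ν s u y) ∧
      ∀ y ∈ children N ν s w u, IsGood N ν s u y

/-- `a 0 = w`, `a 1 = u`, …, `a (s + 1)` is a non-backtracking walk that follows the polls made at
the times `s, s - 1, …, 1`. -/
structure IsBranchWalk (N : Choices V) (s : ℕ) (w u : V) (a : ℕ → V) : Prop where
  zero : a 0 = w
  one : a 1 = u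
  poll : ∀ j < s, a (j + 2) ∈ N (s - 1 - j, a (j + 1))
  ne : ∀ j < s, a (j + 2) ≠ a j

theorem IsBranchWalk.cons {N : Choices V} {s : ℕ} {w u y : V} {a : ℕ → V}
    (h : IsBranchWalk N s u y a) (hy : y ∈ N (s, u)) (hne : y ≠ w) :
    IsBranchWalk N (s + 1) w u fun j => Nat.casesOn j w a where
  zero := rfl
  one := h.zero
  poll j hj := by
    cases j with
    | zero => simpa [h.zero, h.one] using hy
    | succ j =>
      have := h.poll j (by lia)
      simpa [show s - (j + 1) = s - 1 - j by lia] using this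
  ne j hj := by
    cases j with
    | zero => simpa [h.one] using hne
    | succ j => exact h.ne j (by lia)

theorem exists_isBranchWalk_of_mem_leaves {N : Choices V} {ν s : ℕ} {w u y : V}
    (h : y ∈ leaves N ν s w u) : ∃ a, IsBranchWalk N s w u a ∧ a (s + 1) = y := by
  induction s generalizing w u with
  | zero =>
    refine ⟨fun j => Nat.casesOn j w fun _ => u, ⟨rfl, rfl, by simp, by simp⟩, ?_⟩
    simp only [leaves, Finset.mem_singleton] at h
    exact h.symm
  | succ s ih =>
    simp only [leaves, Finset.mem_biUnion] at h
    obtain ⟨z, hz, hy⟩ := h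
    obtain ⟨a, ha, hay⟩ := ih hy
    obtain ⟨hzN, hzw⟩ := mem_of_mem_children hz
    exact ⟨_, ha.cons hzN hzw, hay⟩

/-- A branch that is not good contains two distinct walks of the same length with the same end. -/
theorem exists_isBranchWalk_of_not_isGood {N : Choices V} {ν s : ℕ} {w u : V}
    (h : ¬ IsGood N ν s w u) : ∃ a b, IsBranchWalk N s w u a ∧ IsBranchWalk N s w u b ∧
      a (s + 1) = b (s + 1) ∧ ∃ j ≤ s + 1, a j ≠ b j := by
  induction s generalizing w u with
  | zero => exact absurd trivial h
  | succ s ih =>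
    simp only [IsGood, not_and_or, not_forall, Set.PairwiseDisjoint, Set.Pairwise] at h
    rcases h with ⟨y, hy, z, hz, hyz, hdis⟩ | ⟨y, hy, hbad⟩
    · obtain ⟨q, hqy, hqz⟩ := Finset.not_disjoint_iff.1 hdis
      obtain ⟨a, ha, haq⟩ := exists_isBranchWalk_of_mem_leaves hqy
      obtain ⟨b, hb, hbq⟩ := exists_isBranchWalk_of_mem_leaves hqz
      obtain ⟨hyN, hyw⟩ := mem_of_mem_children hy
      obtain ⟨hzN, hzw⟩ := mem_of_mem_children hz
      -- Both walks start `w, u` and part at index `2`, where they enter different children.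
      refine ⟨_, _, ha.cons hyN hyw, hb.cons hzN hzw, haq.trans hbq.symm, 2, by lia, ?_⟩
      change a 1 ≠ b 1
      rwa [ha.one, hb.one]
    · obtain ⟨a, b, ha, hb, hab, j, hj, hne⟩ := ih hbad
      obtain ⟨hyN, hyw⟩ := mem_of_mem_children hy
      exact ⟨_, _, ha.cons hyN hyw, hb.cons hyN hyw, hab, j + 1, by lia, hne⟩

theorem treeRed_congr {N : Choices V} {ν s : ℕ} {w u : V} {x y : Colouring V}
    (h : ∀ z ∈ leaves N ν s w u, x z = y z) : treeRed N ν s w u x ↔ treeRed N ν s w u y := by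
  induction s generalizing w u with
  | zero => simp [treeRed, h u (by simp [leaves])]
  | succ s ih =>
    classical
    have hz : ∀ z ∈ children N ν s w u, treeRed N ν s u z x ↔ treeRed N ν s u z y :=
      fun z hz => ih fun q hq => h q (by
        simp only [leaves, Finset.mem_biUnion]
        exact ⟨z, hz, hq⟩)
    simp only [treeRed]
    rw [Finset.filter_congr hz]

/-- All steps of the walks follow the polls made at the times `m, m - 1, …, 1`. -/
def IsPolled (N : Choices V) (m : ℕ) (w : Fin 3 × Bool → ℕ → V) : Prop :=
  ∀ i, ∀ j < m, w i (j + 1) ∈ N (m - 1 - j, w i j)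

open Classical in
/-- Three branches that are not good yield a polled witness. -/
theorem exists_isWitness {ν t : ℕ} {N : Choices V} {v : V}
    (hself : ∀ s < t + 1, ∀ u, u ∉ N (s, u))
    (hbad : 2 < ((N (t, v)).filter fun u => ¬ IsGood N ν t v u).card) :
    ∃ w, IsWitness v (t + 1) w ∧ IsPolled N (t + 1) w := by
  obtain ⟨x₁, x₂, x₃, h₁, h₂, h₃, h₁₂, h₁₃, h₂₃⟩ := Finset.two_lt_card_iff.1 hbad
  let x : Fin 3 → V := ![x₁, x₂, x₃]
  have hx : ∀ i, x i ∈ N (t, v) ∧ ¬ IsGood N ν t v (x i) := by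
    intro i
    rw [Finset.mem_filter] at h₁ h₂ h₃
    fin_cases i <;> assumption
  have hinj : Function.Injective x := by
    intro i j hij
    fin_cases i <;> fin_cases j <;> simp_all [x]
  choose a b ha hb hab hne using fun i => exists_isBranchWalk_of_not_isGood (hx i).2
  let w : Fin 3 × Bool → ℕ → V := fun q => if q.2 then a q.1 else b q.1
  have hw : ∀ q : Fin 3 × Bool, IsBranchWalk N t v (x q.1) (w q) := by
    rintro ⟨i, c⟩
    cases c
    · exact hb i
    · exact ha i
  have hpoll : IsPolled N (t + 1) w := by
    intro i j hj
    cases j with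
    | zero => simpa [(hw i).one, (hw i).zero] using (hx i.1).1
    | succ j =>
      have := (hw i).poll j (by lia)
      simpa [show t - (j + 1) = t - 1 - j by lia] using this
  refine ⟨w, ⟨fun i => (hw i).zero, fun i => ?_, fun i j hij => ?_, hab, hne, ?_, ?_⟩, hpoll⟩
  · rw [(hw _).one, (hw _).one]
  · apply hinj
    have := hij
    simpa only [(hw _).one] using this
  · intro i j hj e
    have := hpoll i j hj
    rw [← e] at this
    exact hself _ (by lia) _ this
  · intro i j hj
    exact (hw i).ne j (by lia)

variable [Fintype V]

open Classical in
theorem lt_card_filter_run_eq_false {G : SimpleGraph V} {ν t : ℕ} {x : Colouring V} {N : Choices V}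
    {v : V} (hk : pollSize (2 * ν + 1) (G.degree v) = 2 * ν + 1) (hdeg : G.degree v ≠ 0)
    (hN : (N (t, v)).card = 2 * ν + 1) (h : run G (2 * ν + 1) x N (t + 1) v = false) :
    ν < ((N (t, v)).filter fun u => run G (2 * ν + 1) x N t u = false).card := by
  simp only [run, hdeg, if_false, hk, decide_eq_false_iff_not, not_lt] at h
  have := Finset.card_filter_add_card_filter_not (s := N (t, v))
    (fun u => run G (2 * ν + 1) x N t u = true)
  simp only [Bool.not_eq_true] at this
  lia

-- Exactly one polled vertex is not a child, be it the parent `w` or a surplus vertex. Conceding it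
-- as red loses at most one of the `ν + 1` red polls, so `ν` red children remain.
open Classical in
theorem treeRed_of_run_eq_false {G : SimpleGraph V} {ν t : ℕ} {x : Colouring V} {N : Choices V}
    (hk : ∀ v, pollSize (2 * ν + 1) (G.degree v) = 2 * ν + 1) (hdeg : ∀ v, G.degree v ≠ 0)
    (hN : ∀ s < t, ∀ v, (N (s, v)).card = 2 * ν + 1) {u : V} (w : V)
    (h : run G (2 * ν + 1) x N t u = false) : treeRed N ν t w u x := by
  classical
  induction t generalizing w u with
  | zero => simpa [run, treeRed] using h
  | succ t ih =>
    have h1 := lt_card_filter_run_eq_false (hk u) (hdeg u) (hN t (by lia) u) h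
    simp only [treeRed]
    have hsub : children N ν t w u ⊆ N (t, u) :=
      (children_subset N ν t w u).trans (Finset.erase_subset _ _)
    have h2 : (N (t, u) \ children N ν t w u).card = 1 := by
      rw [Finset.card_sdiff_of_subset hsub, hN t (by lia) u, card_children (hN t (by lia) u)]
      lia
    have h3 : (N (t, u)).filter (fun y => run G (2 * ν + 1) x N t y = false) ⊆
        (children N ν t w u).filter (fun y => treeRed N ν t u y x) ∪
          (N (t, u) \ children N ν t w u) := by
      intro y hy
      rw [Finset.mem_filter] at hy
      by_cases hc : y ∈ children N ν t w u
      · exact Finset.mem_union_left _ (Finset.mem_filter.2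
          ⟨hc, ih (fun s hs => hN s (by lia)) u hy.2⟩)
      · exact Finset.mem_union_right _ (Finset.mem_sdiff.2 ⟨hy.1, hc⟩)
    have h4 := (Finset.card_le_card h3).trans (Finset.card_union_le _ _)
    lia

open Classical in
/-- If at most two of the branches at `v` are not good and `v` is red, then some good branch is
red. -/
theorem exists_isGood_treeRed {G : SimpleGraph V} {ν t : ℕ} (hν : 2 ≤ ν) {x : Colouring V}
    {N : Choices V} (hk : ∀ v, pollSize (2 * ν + 1) (G.degree v) = 2 * ν + 1)
    (hdeg : ∀ v, G.degree v ≠ 0) (hN : ∀ s < t + 1, ∀ v, (N (s, v)).card = 2 * ν + 1) {v : V}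
    (hbad : ((N (t, v)).filter fun u => ¬ IsGood N ν t v u).card ≤ 2)
    (h : run G (2 * ν + 1) x N (t + 1) v = false) :
    ∃ u ∈ N (t, v), IsGood N ν t v u ∧ treeRed N ν t v u x := by
  have h1 := lt_card_filter_run_eq_false (hk v) (hdeg v) (hN t (by lia) v) h
  by_contra! hcon
  have hsub : (N (t, v)).filter (fun u => run G (2 * ν + 1) x N t u = false) ⊆
      (N (t, v)).filter fun u => ¬ IsGood N ν t v u := by
    intro u hu
    rw [Finset.mem_filter] at hu ⊢
    exact ⟨hu.1, fun hg => hcon u hu.1 hg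
      (treeRed_of_run_eq_false hk hdeg (fun s hs => hN s (by lia)) v hu.2)⟩
  -- More than `ν ≥ 2` red branches, all of them bad, contradict the bound of two bad ones.
  have := Finset.card_le_card hsub
  lia

end TreeProcess

/-! ### Independence of the initial colours and the exact recursion on good branches -/

section Independence

variable {V : Type}

/-- Membership in `B` is determined by the colours of the vertices in `D`. -/
def DependsOnColours (B : Set (Colouring V)) (D : Finset V) : Prop :=
  ∀ x y : Colouring V, (∀ z ∈ D, x z = y z) → (x ∈ B ↔ y ∈ B)

theorem DependsOnColours.compl {B : Set (Colouring V)} {D : Finset V}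
    (h : DependsOnColours B D) : DependsOnColours Bᶜ D :=
  fun x y hxy => not_congr (h x y hxy)

theorem dependsOnColours_treeRed (N : Choices V) (ν s : ℕ) (w u : V) :
    DependsOnColours {x | treeRed N ν s w u x} (leaves N ν s w u) :=
  fun _ _ h => treeRed_congr h

variable [Fintype V] {μ : V → Measure Bool} [∀ v, IsProbabilityMeasure (μ v)]

theorem pi_real_inter_of_disjoint {B B' : Set (Colouring V)} {D D' : Finset V}
    (hB : DependsOnColours B D) (hB' : DependsOnColours B' D') (hD : Disjoint D D') :
    (Measure.pi μ).real (B ∩ B') = (Measure.pi μ).real B * (Measure.pi μ).real B' := by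
  classical
  have hind : iIndepFun (fun (i : V) (ω : Colouring V) => ω i) (Measure.pi μ) :=
    iIndepFun_pi (X := fun _ => id) fun _ => aemeasurable_id
  have h2 := hind.indepFun_finset D D' hD fun i => measurable_pi_apply i
  -- The value `false` outside `D` is arbitrary: membership in `B` sees only the colours on `D`.
  let ext : (D : Finset V) → (D → Bool) → Colouring V := fun D r v =>
    if h : v ∈ D then r ⟨v, h⟩ else false
  have key : ∀ (B : Set (Colouring V)) (D : Finset V), DependsOnColours B D →
      B = (fun (x : Colouring V) (i : D) => x i) ⁻¹' {r | ext D r ∈ B} := by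
    intro B D h
    ext x
    exact h _ _ fun z hz => by simp [ext, hz]
  have h3 := h2.measure_inter_preimage_eq_mul {r | ext D r ∈ B} {r | ext D' r ∈ B'}
    .of_discrete .of_discrete
  rw [← key B D hB, ← key B' D' hB'] at h3
  rw [measureReal_def, h3, ENNReal.toReal_mul]
  rfl

theorem pi_real_biInter {ι : Type*} (C : Finset ι) {B : ι → Set (Colouring V)}
    {D : ι → Finset V} (hB : ∀ i ∈ C, DependsOnColours (B i) (D i))
    (hD : (C : Set ι).PairwiseDisjoint D) :
    (Measure.pi μ).real (⋂ i ∈ C, B i) = ∏ i ∈ C, (Measure.pi μ).real (B i) := by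
  classical
  induction C using Finset.induction_on with
  | empty => simp
  | insert a C ha ih =>
    rw [Finset.set_biInter_insert, Finset.prod_insert ha,
      pi_real_inter_of_disjoint (D := D a) (D' := C.biUnion D) (hB a (by simp)) ?_ ?_,
      ih (fun i hi => hB i (Finset.mem_insert_of_mem hi)) (hD.subset (by simp))]
    · intro x y hxy
      simp only [Set.mem_iInter]
      refine forall₂_congr fun i hi => hB i (Finset.mem_insert_of_mem hi) x y fun z hz => hxy z ?_
      exact Finset.mem_biUnion.2 ⟨i, hi, hz⟩
    · rw [Finset.disjoint_biUnion_right]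
      exact fun i hi => hD (by simp) (by simp [hi]) (by rintro rfl; exact ha hi)

/-- The probability that at least `ν` out of `2 * ν` independent events of probability `p` occur. -/
noncomputable def binomialTail (ν : ℕ) (p : ℝ) : ℝ :=
  ∑ k ∈ (Finset.range (2 * ν + 1)).filter (ν ≤ ·),
    ((2 * ν).choose k : ℝ) * (p ^ k * (1 - p) ^ (2 * ν - k))

-- Split according to the exact set `A` of events that occur. The cells are disjoint, and by
-- independence the probability of a cell depends only on the size of `A`.
open Classical in
theorem pi_real_le_card_filter {ι : Type*} {C : Finset ι} {ν : ℕ} (hC : C.card = 2 * ν)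
    {B : ι → Set (Colouring V)} {D : ι → Finset V}
    (hB : ∀ i ∈ C, DependsOnColours (B i) (D i)) (hD : (C : Set ι).PairwiseDisjoint D) {p : ℝ}
    (hp : ∀ i ∈ C, (Measure.pi μ).real (B i) = p) :
    (Measure.pi μ).real {x | ν ≤ (C.filter fun i => x ∈ B i).card} = binomialTail ν p := by
  have h1 : {x | ν ≤ (C.filter fun i => x ∈ B i).card} =
      ⋃ A ∈ C.powerset.filter (fun A => ν ≤ A.card),
        ⋂ i ∈ C, (if i ∈ A then B i else (B i)ᶜ) := by
    ext x
    simp only [Set.mem_ofPred_eq, Set.mem_iUnion, Set.mem_iInter, Finset.mem_filter,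
      Finset.mem_powerset, exists_prop]
    constructor
    · intro h
      refine ⟨C.filter fun i => x ∈ B i, ⟨Finset.filter_subset _ _, h⟩, fun i hi => ?_⟩
      by_cases hx : x ∈ B i <;> simp [hi, hx]
    · rintro ⟨A, ⟨hA, hcard⟩, h⟩
      have : C.filter (fun i => x ∈ B i) = A := by
        ext i
        simp only [Finset.mem_filter]
        constructor
        · rintro ⟨hi, hx⟩
          by_contra hiA
          have := h i hi
          simp [hiA, hx] at this
        · intro hiA
          have := h i (hA hiA)
          simp only [hiA, if_true] at this
          exact ⟨hA hiA, this⟩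
      rwa [this]
  have hdep : ∀ A : Finset ι, ∀ i ∈ C, DependsOnColours (if i ∈ A then B i else (B i)ᶜ) (D i) := by
    intro A i hi
    split_ifs
    · exact hB i hi
    · exact (hB i hi).compl
  rw [h1, measureReal_biUnion_finset ?_ (fun _ _ => .of_discrete)]
  · have h2 : ∀ A ∈ C.powerset.filter (fun A => ν ≤ A.card),
        (Measure.pi μ).real (⋂ i ∈ C, (if i ∈ A then B i else (B i)ᶜ)) =
          p ^ A.card * (1 - p) ^ (2 * ν - A.card) := by
      intro A hA
      rw [Finset.mem_filter, Finset.mem_powerset] at hA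
      rw [pi_real_biInter C (hdep A) hD]
      have h3 : ∀ i ∈ C, (Measure.pi μ).real (if i ∈ A then B i else (B i)ᶜ) =
          if i ∈ A then p else 1 - p := by
        intro i hi
        split_ifs
        · exact hp i hi
        · rw [probReal_compl_eq_one_sub .of_discrete, hp i hi]
      rw [Finset.prod_congr rfl h3, Finset.prod_ite, Finset.prod_const, Finset.prod_const,
        Finset.filter_mem_eq_inter, Finset.inter_eq_right.2 hA.1, Finset.filter_notMem_eq_sdiff,
        Finset.card_sdiff_of_subset hA.1, hC]
    rw [Finset.sum_congr rfl h2, Finset.sum_filter]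
    have h4 := Finset.sum_powerset_apply_card
      (fun k => if ν ≤ k then p ^ k * (1 - p) ^ (2 * ν - k) else 0) (x := C)
    rw [h4, hC, binomialTail, Finset.sum_filter]
    refine Finset.sum_congr rfl fun k _ => ?_
    split_ifs <;> simp
  · intro A hA A' hA' hne
    simp only [Finset.coe_filter, Set.mem_ofPred_eq, Finset.mem_powerset] at hA hA'
    rw [Function.onFun, Set.disjoint_left]
    intro x hx hx'
    simp only [Set.mem_iInter] at hx hx'
    refine hne (Finset.ext fun i => ⟨fun hi => ?_, fun hi => ?_⟩) <;> by_contra hn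
    · have e1 := hx i (hA.1 hi)
      have e2 := hx' i (hA.1 hi)
      simp only [hi, hn, if_true, if_false] at e1 e2
      exact e2 e1
    · have e1 := hx i (hA'.1 hi)
      have e2 := hx' i (hA'.1 hi)
      simp only [hi, hn, if_true, if_false] at e1 e2
      exact e1 e2

/-- The law of the initial colouring. -/
noncomputable abbrev colourLaw (V : Type) [Fintype V] (α : I) : Measure (Colouring V) :=
  Measure.pi fun _ : V => bernoulliMeasure false true α

theorem colourLaw_real_eq_false (α : I) (u : V) :
    (colourLaw V α).real {x | x u = false} = α := by
  have h := (measurePreserving_eval (fun _ : V => bernoulliMeasure false true α)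
    u).measureReal_preimage (s := ({false} : Set Bool)) MeasurableSet.of_discrete.nullMeasurableSet
  have e : {x : Colouring V | x u = false} = Function.eval u ⁻¹' ({false} : Set Bool) := by
    ext; simp
  rw [e, h, bernoulliMeasure_real_apply _ .of_discrete]
  simp

/-- On a good branch the probability of `treeRed` follows the recursion of a regular tree. -/
theorem colourLaw_real_treeRed {α : I} {N : Choices V} {ν t : ℕ}
    (hN : ∀ s < t, ∀ v, (N (s, v)).card = 2 * ν + 1) {w u : V} (h : IsGood N ν t w u) :
    (colourLaw V α).real {x | treeRed N ν t w u x} = (binomialTail ν)^[t] α := by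
  induction t generalizing w u with
  | zero => simpa [treeRed] using colourLaw_real_eq_false α u
  | succ t ih =>
    rw [Function.iterate_succ_apply']
    exact pi_real_le_card_filter (card_children (hN t (by lia) u))
      (B := fun y => {x | treeRed N ν t u y x}) (D := fun y => leaves N ν t u y)
      (fun y _ => dependsOnColours_treeRed N ν t u y) h.1
      (fun y hy => ih (fun s hs => hN s (by lia)) (h.2 y hy))

end Independence

/-! ### Iterating the binomial tail -/

section BinomialTail

/-- Only a factor `2 * ν` is needed later, but that weaker bound does not pass from `ν` to `ν + 1`,
whereas the one with `3 * ν + 1` does. -/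
theorem centralBinom_sq_mul_le (ν : ℕ) : ν.centralBinom ^ 2 * (3 * ν + 1) ≤ 16 ^ ν := by
  induction ν with
  | zero => simp
  | succ ν ih =>
    have h := Nat.succ_mul_centralBinom_succ ν
    have h1 : (ν + 1) ^ 2 * ((ν + 1).centralBinom ^ 2 * (3 * (ν + 1) + 1)) =
        ν.centralBinom ^ 2 * (4 * (2 * ν + 1) ^ 2 * (3 * ν + 4)) := by
      have : ((ν + 1) * (ν + 1).centralBinom) ^ 2 = (2 * (2 * ν + 1) * ν.centralBinom) ^ 2 := by
        rw [h]
      linear_combination (3 * ν + 4) * this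
    have h2 : 4 * (2 * ν + 1) ^ 2 * (3 * ν + 4) ≤ 16 * (ν + 1) ^ 2 * (3 * ν + 1) := by
      nlinarith
    have h3 : (ν + 1) ^ 2 * ((ν + 1).centralBinom ^ 2 * (3 * (ν + 1) + 1)) ≤
        (ν + 1) ^ 2 * 16 ^ (ν + 1) := by
      rw [h1]
      calc _ ≤ ν.centralBinom ^ 2 * (16 * (ν + 1) ^ 2 * (3 * ν + 1)) := Nat.mul_le_mul_left _ h2
        _ = (ν + 1) ^ 2 * 16 * (ν.centralBinom ^ 2 * (3 * ν + 1)) := by ring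
        _ ≤ (ν + 1) ^ 2 * 16 * 16 ^ ν := Nat.mul_le_mul_left _ ih
        _ = _ := by ring
    exact Nat.le_of_mul_le_mul_left h3 (by positivity)

theorem centralBinom_le {ν : ℕ} (hν : 0 < ν) :
    (ν.centralBinom : ℝ) ≤ 4 ^ ν * (1 / Real.sqrt (2 * ν)) := by
  have hpos : (0 : ℝ) < 2 * ν := by positivity
  rw [mul_one_div, le_div_iff₀ (Real.sqrt_pos.2 hpos)]
  refine le_of_sq_le_sq ?_ (by positivity)
  rw [mul_pow, Real.sq_sqrt hpos.le, ← pow_mul, mul_comm ν 2, pow_mul]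
  have h : ((ν.centralBinom : ℝ)) ^ 2 * (3 * ν + 1) ≤ 16 ^ ν := by
    exact_mod_cast centralBinom_sq_mul_le ν
  norm_num
  nlinarith [sq_nonneg (ν.centralBinom : ℝ)]

/-- By the symmetry `k ↦ 2 * ν - k` the upper and lower halves have equal sums; together they cover
the whole row and count the middle term twice. -/
theorem two_mul_sum_choose (ν : ℕ) :
    2 * ∑ k ∈ (Finset.range (2 * ν + 1)).filter (ν ≤ ·), (2 * ν).choose k =
      4 ^ ν + ν.centralBinom := by
  have h1 : ∑ k ∈ (Finset.range (2 * ν + 1)).filter (ν ≤ ·), (2 * ν).choose k =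
      ∑ k ∈ (Finset.range (2 * ν + 1)).filter (· ≤ ν), (2 * ν).choose k := by
    refine Finset.sum_nbij' (fun k => 2 * ν - k) (fun k => 2 * ν - k) ?_ ?_ ?_ ?_ ?_ <;>
      simp only [Finset.mem_filter, Finset.mem_range]
    · lia
    · lia
    · lia
    · lia
    · intro k hk
      exact (Nat.choose_symm (by lia)).symm
  have h2 : (Finset.range (2 * ν + 1)).filter (· ≤ ν) =
      insert ν ((Finset.range (2 * ν + 1)).filter fun k => ¬ ν ≤ k) := by
    ext k
    simp only [Finset.mem_filter, Finset.mem_range, Finset.mem_insert]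
    lia
  have h3 := Finset.sum_filter_add_sum_filter_not (Finset.range (2 * ν + 1)) (ν ≤ ·)
    fun k => (2 * ν).choose k
  rw [Nat.sum_range_choose, pow_mul] at h3
  rw [h2, Finset.sum_insert (by simp)] at h1
  rw [Nat.centralBinom]
  norm_num at h3
  lia

theorem binomialTail_nonneg {ν : ℕ} {p : ℝ} (h₀ : 0 ≤ p) (h₁ : p ≤ 1) : 0 ≤ binomialTail ν p :=
  Finset.sum_nonneg fun _ _ => mul_nonneg (Nat.cast_nonneg _)
    (mul_nonneg (pow_nonneg h₀ _) (pow_nonneg (by linarith) _))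

/-- As `p ≤ 1 - p`, every term with `k ≥ ν` has weight at most that of `k = ν`; what remains is half
a row of Pascal's triangle. The factor `4` puts the bound in terms of `4p(1 - p)`, ready for
iteration. -/
theorem binomialTail_le {ν : ℕ} (hν : 0 < ν) {p : ℝ} (h₀ : 0 ≤ p) (h₁ : p ≤ 1 / 2) :
    4 * binomialTail ν p ≤ (1 + 1 / Real.sqrt (2 * ν)) * 2 * (4 * p * (1 - p)) ^ ν := by
  have hterm : ∀ k ∈ (Finset.range (2 * ν + 1)).filter (ν ≤ ·),
      ((2 * ν).choose k : ℝ) * (p ^ k * (1 - p) ^ (2 * ν - k)) ≤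
        ((2 * ν).choose k : ℝ) * (p * (1 - p)) ^ ν := by
    intro k hk
    simp only [Finset.mem_filter, Finset.mem_range] at hk
    refine mul_le_mul_of_nonneg_left ?_ (Nat.cast_nonneg _)
    obtain ⟨i, rfl⟩ := Nat.exists_eq_add_of_le hk.2
    obtain ⟨l, rfl⟩ : ∃ l, ν = i + l := Nat.exists_eq_add_of_le (by lia)
    rw [show 2 * (i + l) - (i + l + i) = l by lia, mul_pow, pow_add p (i + l), pow_add (1 - p) i,
      mul_assoc]
    refine mul_le_mul_of_nonneg_left ?_ (by positivity)
    exact mul_le_mul_of_nonneg_right (pow_le_pow_left₀ h₀ (by linarith) _)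
      (pow_nonneg (by linarith) _)
  have h2 : binomialTail ν p ≤
      (∑ k ∈ (Finset.range (2 * ν + 1)).filter (ν ≤ ·), ((2 * ν).choose k : ℝ)) *
        (p * (1 - p)) ^ ν := by
    rw [Finset.sum_mul]
    exact Finset.sum_le_sum hterm
  have h3 : 2 * (∑ k ∈ (Finset.range (2 * ν + 1)).filter (ν ≤ ·), ((2 * ν).choose k : ℝ)) =
      4 ^ ν + ν.centralBinom := by
    exact_mod_cast two_mul_sum_choose ν
  have h4 := centralBinom_le hν
  have h5 : 0 ≤ (p * (1 - p)) ^ ν := pow_nonneg (mul_nonneg h₀ (by linarith)) _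
  calc 4 * binomialTail ν p ≤ 2 * (4 ^ ν + ν.centralBinom) * (p * (1 - p)) ^ ν := by
        rw [← h3]; linarith
    _ ≤ 2 * (4 ^ ν + 4 ^ ν * (1 / Real.sqrt (2 * ν))) * (p * (1 - p)) ^ ν := by gcongr
    _ = _ := by rw [mul_assoc 4 p, mul_pow 4]; ring

/-- Iterating `binomialTail ν` decreases doubly exponentially below the threshold. -/
theorem iterate_binomialTail_le {ν : ℕ} (hν : 2 ≤ ν) {p β : ℝ} (h₀ : 0 ≤ p) (h₁ : p ≤ 1 / 2)
    (hβ : β ≤ 1)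
    (h : ((1 + 1 / Real.sqrt (2 * ν)) * 2) ^ (1 / ((ν : ℝ) - 1)) * (4 * p * (1 - p)) ≤ β) (s : ℕ) :
    (binomialTail ν)^[s] p ≤ β ^ ν ^ s := by
  set K : ℝ := (1 + 1 / Real.sqrt (2 * ν)) * 2 with hK
  set C : ℝ := K ^ (1 / ((ν : ℝ) - 1)) with hC
  have hν' : (0 : ℝ) < (ν : ℝ) - 1 := by
    have : (2 : ℝ) ≤ ν := by exact_mod_cast hν
    linarith
  have hK1 : 1 ≤ K := by
    have : 0 ≤ 1 / Real.sqrt (2 * ν) := by positivity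
    linarith
  have hC1 : 1 ≤ C := Real.one_le_rpow hK1 (by positivity)
  -- `C` is chosen with `C ^ (ν - 1) = K`, so that in the step `y ↦ K * y ^ ν` the constant is
  -- absorbed: `C * K * y ^ ν = (C * y) ^ ν`.
  have hCK : C * K = C ^ ν := by
    have : C ^ (ν - 1) = K := by
      rw [hC, ← Real.rpow_natCast, ← Real.rpow_mul (by linarith), Nat.cast_sub (by lia),
        Nat.cast_one, one_div_mul_cancel hν'.ne', Real.rpow_one]
    rw [← this, ← pow_succ', Nat.sub_add_cancel (by lia)]
  have hβ0 : 0 ≤ β := le_trans (mul_nonneg (by linarith) (mul_nonneg (by linarith) (by linarith))) h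
  -- The quantity that is raised to the power `ν` at each step is `C * 4g(1 - g)`, not `g`. The
  -- bound `1 / 2` is carried along because the one-step estimate requires it.
  have main : ∀ s, 0 ≤ (binomialTail ν)^[s] p ∧ (binomialTail ν)^[s] p ≤ 1 / 2 ∧
      C * (4 * (binomialTail ν)^[s] p * (1 - (binomialTail ν)^[s] p)) ≤ β ^ ν ^ s := by
    intro s
    induction s with
    | zero => exact ⟨h₀, h₁, by simpa using h⟩
    | succ s ih =>
      rw [Function.iterate_succ_apply']
      set g := (binomialTail ν)^[s] p
      obtain ⟨g0, g1, g2⟩ := ih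
      have hq : 0 ≤ 4 * g * (1 - g) := mul_nonneg (by linarith) (by linarith)
      have hle := binomialTail_le (show 0 < ν by lia) g0 g1
      rw [← hK] at hle
      have hn := binomialTail_nonneg (ν := ν) g0 (by linarith)
      have hpow : C * K * (4 * g * (1 - g)) ^ ν ≤ β ^ ν ^ (s + 1) := by
        rw [hCK, ← mul_pow, pow_succ, pow_mul]
        exact pow_le_pow_left₀ (mul_nonneg (by linarith) hq) g2 _
      have h4 : C * (4 * binomialTail ν g) ≤ β ^ ν ^ (s + 1) := by
        refine le_trans ?_ hpow
        rw [mul_assoc]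
        exact mul_le_mul_of_nonneg_left hle (by linarith)
      have h5 : 4 * binomialTail ν g ≤ 1 := by
        have : β ^ ν ^ (s + 1) ≤ 1 := pow_le_one₀ hβ0 hβ
        nlinarith
      refine ⟨hn, by linarith, le_trans ?_ h4⟩
      refine mul_le_mul_of_nonneg_left ?_ (by linarith)
      nlinarith
  obtain ⟨g0, g1, g2⟩ := main s
  generalize (binomialTail ν)^[s] p = g at *
  have h2 : 0 ≤ g * (1 / 2 - g) := mul_nonneg g0 (by linarith)
  have h3 : 0 ≤ (C - 1) * (g * (1 - g)) :=
    mul_nonneg (by linarith) (mul_nonneg g0 (by linarith))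
  linarith

end BinomialTail

/-! ### Blue is initially the majority colour -/

section InitialMajority

variable {V : Type} [Fintype V]

theorem pow_mul_pow_le_sqrt_pow {p : ℝ} (h₀ : 0 ≤ p) (h₁ : p ≤ 1 / 2) {a b : ℕ} (hab : a ≤ b) :
    p ^ b * (1 - p) ^ a ≤ Real.sqrt (p * (1 - p)) ^ (a + b) := by
  obtain ⟨c, rfl⟩ := Nat.exists_eq_add_of_le hab
  have hp : p ≤ Real.sqrt (p * (1 - p)) := by
    refine Real.le_sqrt_of_sq_le ?_
    nlinarith
  calc p ^ (a + c) * (1 - p) ^ a = (p * (1 - p)) ^ a * p ^ c := by rw [pow_add, mul_pow]; ring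
    _ ≤ (p * (1 - p)) ^ a * Real.sqrt (p * (1 - p)) ^ c := by
        refine mul_le_mul_of_nonneg_left (pow_le_pow_left₀ h₀ hp _)
          (pow_nonneg (mul_nonneg h₀ (by linarith)) _)
    _ = Real.sqrt (p * (1 - p)) ^ (a + (a + c)) := by
        rw [← add_assoc, pow_add, ← two_mul, pow_mul, Real.sq_sqrt]
        exact mul_nonneg h₀ (by linarith)

/-- A colouring with at least as many red as blue vertices has probability at most `√(α(1 - α)) ^
n`, and there are at most `2 ^ n` of them. -/
theorem colourLaw_real_not_isMajority {α : I} (hα : (α : ℝ) ≤ 1 / 2) :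
    (colourLaw V α).real {x | ¬ IsMajority x true} ≤
      (2 * Real.sqrt (α * (1 - α))) ^ Fintype.card V := by
  classical
  have hfin : {x : Colouring V | ¬ IsMajority x true} =
      ((Finset.univ.filter fun x : Colouring V => ¬ IsMajority x true : Finset _) : Set _) := by
    ext; simp
  have hone : ∀ x ∈ Finset.univ.filter (fun x : Colouring V => ¬ IsMajority x true),
      (colourLaw V α).real {x} ≤ Real.sqrt (α * (1 - α)) ^ Fintype.card V := by
    intro x hx
    simp only [Finset.mem_filter, Finset.mem_univ, true_and, IsMajority, not_lt] at hx
    have hsum := Finset.card_filter_add_card_filter_not (s := (Finset.univ : Finset V))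
      (fun v => x v = true)
    rw [Finset.card_univ] at hsum
    have hval : (colourLaw V α).real {x} =
        (α : ℝ) ^ (Finset.univ.filter fun v => ¬ x v = true).card *
          (1 - α) ^ (Finset.univ.filter fun v => x v = true).card := by
      rw [measureReal_def, Measure.pi_singleton, ENNReal.toReal_prod,
        ← Finset.prod_filter_mul_prod_filter_not _ (fun v => x v = true), mul_comm]
      congr 1
      · rw [← Finset.prod_const]
        refine Finset.prod_congr rfl fun v hv => ?_
        have hv' : x v = false := by simpa using hv
        rw [hv', ← measureReal_def, bernoulliMeasure_real_apply _ .of_discrete]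
        simp
      · rw [← Finset.prod_const]
        refine Finset.prod_congr rfl fun v hv => ?_
        have hv' : x v = true := by simpa using hv
        rw [hv', ← measureReal_def, bernoulliMeasure_real_apply _ .of_discrete]
        simp
    rw [hval, ← hsum]
    exact pow_mul_pow_le_sqrt_pow α.2.1 hα (by lia)
  rw [hfin, ← sum_measureReal_singleton]
  refine (Finset.sum_le_card_nsmul _ _ _ hone).trans ?_
  rw [nsmul_eq_mul, mul_pow]
  refine mul_le_mul_of_nonneg_right ?_ (by positivity)
  have := Finset.card_filter_le (Finset.univ : Finset (Colouring V)) fun x => ¬ IsMajority x true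
  rw [Finset.card_univ, Fintype.card_fun, Fintype.card_bool] at this
  exact_mod_cast this

end InitialMajority

/-! ### The probability that prescribed polls are made -/

section Polls

/-- The ratio of the two binomial coefficients is the product of `(d - i) / (D - i)` over `i < x`,
and each factor is at most `d / D`. -/
theorem choose_sub_mul_pow_le {D d x : ℕ} (hx : x ≤ d) (hd : d ≤ D) :
    (D - x).choose (d - x) * D ^ x ≤ D.choose d * d ^ x := by
  induction x with
  | zero => simp
  | succ x ih =>
    have hpos : 0 < D - x := by lia
    refine Nat.le_of_mul_le_mul_left ?_ hpos
    have h1 := Nat.add_one_mul_choose_eq (D - x - 1) (d - x - 1)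
    rw [show D - x - 1 + 1 = D - x by lia, show d - x - 1 + 1 = d - x by lia] at h1
    have h2 : (d - x) * D ≤ d * (D - x) := by
      zify [show x ≤ d by lia, show x ≤ D by lia]
      nlinarith [show (x : ℤ) * d ≤ x * D by gcongr]
    calc (D - x) * ((D - (x + 1)).choose (d - (x + 1)) * D ^ (x + 1))
        = ((D - x) * (D - x - 1).choose (d - x - 1)) * D ^ (x + 1) := by
          rw [Nat.sub_sub, Nat.sub_sub]; ring
      _ = ((D - x).choose (d - x) * D ^ x) * ((d - x) * D) := by rw [h1]; ring
      _ ≤ (D.choose d * d ^ x) * (d * (D - x)) := Nat.mul_le_mul (ih (by lia)) h2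
      _ = _ := by ring

theorem card_filter_superset_mul_le {ι : Type*} [DecidableEq ι] {S X : Finset ι} {d : ℕ}
    (hd : d ≤ S.card) :
    ((S.powersetCard d).filter fun F => X ⊆ F).card * S.card ^ X.card ≤
      (S.powersetCard d).card * d ^ X.card := by
  rcases Finset.eq_empty_or_nonempty ((S.powersetCard d).filter fun F => X ⊆ F) with h | ⟨F, hF⟩
  · simp [h]
  · simp only [Finset.mem_filter, Finset.mem_powersetCard] at hF
    have hXS : X ⊆ S := hF.2.trans hF.1.1
    have hXd : X.card ≤ d := hF.1.2 ▸ Finset.card_le_card hF.2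
    have h1 : ((S.powersetCard d).filter fun F => X ⊆ F).card ≤
        (S.card - X.card).choose (d - X.card) := by
      rw [← Finset.card_sdiff_of_subset hXS, ← Finset.card_powersetCard]
      refine Finset.card_le_card_of_injOn (fun F => F \ X) ?_ ?_
      · intro F hF
        simp only [Finset.coe_filter, Set.mem_ofPred_eq, Finset.mem_powersetCard] at hF
        simp only [Finset.mem_coe, Finset.mem_powersetCard]
        exact ⟨Finset.sdiff_subset_sdiff hF.1.1 le_rfl,
          by rw [Finset.card_sdiff_of_subset hF.2, hF.1.2]⟩
      · intro F hF F' hF' h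
        simp only [Finset.coe_filter, Set.mem_ofPred_eq] at hF hF'
        rw [← Finset.sdiff_union_of_subset hF.2, ← Finset.sdiff_union_of_subset hF'.2]
        exact congrArg (· ∪ X) h
    rw [Finset.card_powersetCard]
    exact (Nat.mul_le_mul_right _ h1).trans (choose_sub_mul_pow_le hXd hd)

variable {V : Type} [Fintype V]

theorem pollSize_eq {k m : ℕ} (hk : Odd k) (h : k ≤ m) : pollSize k m = k := by
  obtain ⟨l, rfl⟩ := hk
  unfold pollSize
  lia

theorem pollLaw_real_apply (G : SimpleGraph V) (k : ℕ) (v : V) (P : Finset V → Prop)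
    [DecidablePred P] :
    (pollLaw G k v).real {F | P F} = ((polls G k v).filter P).card / (polls G k v).card := by
  classical
  rw [pollLaw, measureReal_def, PMF.toMeasure_uniformOfFinset_apply, ENNReal.toReal_div]
  · simp
  · exact .of_discrete

open Classical in
theorem pollLaw_real_superset_le {G : SimpleGraph V} {k : ℕ} (hk : Odd k) {v : V}
    (hdeg : k ≤ G.degree v) {r : ℝ} (hr : (k : ℝ) ≤ r * G.degree v) (X : Finset V) :
    (pollLaw G k v).real {F | X ⊆ F} ≤ r ^ X.card := by
  have hkpos : 0 < k := hk.pos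
  have hDpos : (0 : ℝ) < G.degree v := by exact_mod_cast lt_of_lt_of_le hkpos hdeg
  rw [pollLaw_real_apply, div_le_iff₀ (by exact_mod_cast (polls_nonempty G k v).card_pos)]
  have h := card_filter_superset_mul_le (S := G.neighborFinset v) (X := X) (d := k) hdeg
  rw [SimpleGraph.card_neighborFinset_eq_degree] at h
  have hp : polls G k v = (G.neighborFinset v).powersetCard k := by
    rw [polls, pollSize_eq hk hdeg]
  rw [← hp] at h
  have h' : (((polls G k v).filter fun F => X ⊆ F).card : ℝ) * (G.degree v : ℝ) ^ X.card ≤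
      (polls G k v).card * (k : ℝ) ^ X.card := by exact_mod_cast h
  have h2 : (k : ℝ) ^ X.card ≤ r ^ X.card * (G.degree v : ℝ) ^ X.card := by
    rw [← mul_pow]
    exact pow_le_pow_left₀ (by positivity) hr _
  have hpow : (0 : ℝ) < (G.degree v : ℝ) ^ X.card := by positivity
  refine le_of_mul_le_mul_right (h'.trans ?_) hpow
  calc _ ≤ ((polls G k v).card : ℝ) * (r ^ X.card * (G.degree v : ℝ) ^ X.card) := by gcongr
    _ = _ := by ring

theorem pollLaw_real_superset_eq_zero {G : SimpleGraph V} {k : ℕ} {v y : V} (h : ¬ G.Adj v y)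
    {X : Finset V} (hy : y ∈ X) : (pollLaw G k v).real {F | X ⊆ F} = 0 := by
  classical
  rw [pollLaw_real_apply, Finset.filter_eq_empty_iff.2]
  · simp
  · intro F hF hX
    rw [polls, Finset.mem_powersetCard] at hF
    exact h ((SimpleGraph.mem_neighborFinset _ _ _).1 (hF.1 (hX hy)))

/-- The law of the polling choices. -/
noncomputable abbrev choicesLaw (G : SimpleGraph V) (k : ℕ) : Measure (Choices V) :=
  Measure.infinitePi fun i : ℕ × V => pollLaw G k i.2

theorem ae_mem_polls (G : SimpleGraph V) (k : ℕ) :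
    ∀ᵐ N ∂choicesLaw G k, ∀ s v, N (s, v) ∈ polls G k v := by
  classical
  rw [ae_all_iff]
  intro s
  rw [ae_all_iff]
  intro v
  have h := (measurePreserving_eval_infinitePi (fun i : ℕ × V => pollLaw G k i.2)
    (s, v)).quasiMeasurePreserving.ae (p := fun F => F ∈ polls G k v) ?_
  · exact h
  · rw [ae_iff, ← measureReal_eq_zero_iff, pollLaw_real_apply, Finset.filter_eq_empty_iff.2]
    · simp
    · simp

/-- The vertices which `u` has to poll at time `s + 1` for the walks `w` to be polled. -/
def required [DecidableEq V] (m : ℕ) (w : Fin 3 × Bool → ℕ → V) (i : ℕ × V) : Finset V :=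
  (Finset.univ.filter fun q => w q (m - 1 - i.1) = i.2).image fun q => w q (m - i.1)

/-- Every used edge is demanded by at least one poll. An edge traversed at several times or in both
directions is demanded repeatedly, hence only an inequality. -/
theorem card_walkEdges_le [DecidableEq V] (m : ℕ) (w : Fin 3 × Bool → ℕ → V) :
    (walkEdges m w).card ≤ ∑ i ∈ Finset.range m ×ˢ Finset.univ, (required m w i).card := by
  refine le_trans (Finset.card_le_card (t := (Finset.range m ×ˢ Finset.univ).biUnion
    fun i => (required m w i).image fun y => s(i.2, y)) ?_) ?_
  · intro e he
    obtain ⟨⟨q, j⟩, hq, rfl⟩ := Finset.mem_image.1 he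
    have hj : j < m := by simpa using hq
    refine Finset.mem_biUnion.2 ⟨(m - 1 - j, w q j), by simp; lia, ?_⟩
    refine Finset.mem_image.2 ⟨w q (j + 1), Finset.mem_image.2 ⟨q, ?_, ?_⟩, rfl⟩
    · simp [show m - 1 - (m - 1 - j) = j by lia]
    · simp [show m - (m - 1 - j) = j + 1 by lia]
  · exact Finset.card_biUnion_le.trans (Finset.sum_le_sum fun i _ => Finset.card_image_le)

-- Polls at different pairs (time, vertex) are independent, so being polled costs a factor `r` per
-- required vertex. As `r ≤ 1`, keeping one factor per distinct edge is enough.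
open Classical in
theorem choicesLaw_real_isPolled_le [DecidableEq V] {G : SimpleGraph V} {k : ℕ} (hk : Odd k)
    (hdeg : ∀ v, k ≤ G.degree v) {r : ℝ} (hr : ∀ v, (k : ℝ) ≤ r * G.degree v) (hr₁ : r ≤ 1)
    (hr₀ : 0 ≤ r) (m : ℕ) (w : Fin 3 × Bool → ℕ → V) :
    (choicesLaw G k).real {N | IsPolled N m w} ≤
      if (walkEdges m w : Set (Sym2 V)) ⊆ G.edgeSet then r ^ (walkEdges m w).card else 0 := by
  have hsub : {N | IsPolled N m w} ⊆ Set.pi (Finset.range m ×ˢ Finset.univ : Finset (ℕ × V))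
      fun i => {F | required m w i ⊆ F} := by
    rintro N hN ⟨s, u⟩ hs y hy
    simp only [Finset.coe_product, Finset.coe_range, Finset.coe_univ, Set.mem_prod,
      Set.mem_Iio, Set.mem_univ, and_true] at hs
    simp only [required, Finset.mem_image, Finset.mem_filter, Finset.mem_univ, true_and] at hy
    obtain ⟨q, hq, rfl⟩ := hy
    have := hN q (m - 1 - s) (by lia)
    rwa [hq, show m - 1 - s + 1 = m - s by lia, show m - 1 - (m - 1 - s) = s by lia] at this
  refine (measureReal_mono hsub).trans ?_
  rw [measureReal_def, Measure.infinitePi_pi _ (fun _ _ => .of_discrete), ENNReal.toReal_prod]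
  split_ifs with hE
  · have hle : ∀ i : ℕ × V, (pollLaw G k i.2).real {F | required m w i ⊆ F} ≤
        r ^ (required m w i).card := fun i =>
      pollLaw_real_superset_le hk (hdeg i.2) (hr i.2) (required m w i)
    calc ∏ i ∈ Finset.range m ×ˢ Finset.univ, (pollLaw G k i.2).real {F | required m w i ⊆ F}
        ≤ ∏ i ∈ Finset.range m ×ˢ Finset.univ, r ^ (required m w i).card :=
          Finset.prod_le_prod (fun _ _ => measureReal_nonneg) fun i _ => hle i
      _ ≤ r ^ (walkEdges m w).card := ?_
    rw [Finset.prod_pow_eq_pow_sum]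
    exact pow_le_pow_of_le_one hr₀ hr₁ (card_walkEdges_le m w)
  · obtain ⟨e, he, hnot⟩ := Set.not_subset.1 hE
    obtain ⟨⟨q, j⟩, hq, rfl⟩ := Finset.mem_image.1 (Finset.mem_coe.1 he)
    have hj : j < m := by simpa using hq
    refine (Finset.prod_eq_zero (i := (m - 1 - j, w q j)) (by simp; lia) ?_).le
    refine pollLaw_real_superset_eq_zero (y := w q (j + 1)) (by simpa using hnot) ?_
    refine Finset.mem_image.2 ⟨q, ?_, ?_⟩
    · simp [show m - 1 - (m - 1 - j) = j by lia]
    · simp [show m - (m - 1 - j) = j + 1 by lia]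

end Polls

/-! ### Edges and degrees of the binomial random graph -/

section RandomGraph

variable {V : Type} [Fintype V]

/-- The law of the indicator of the edge `e` in the binomial random graph. -/
noncomputable abbrev edgeLaw (p : I) (e : Sym2 V) : Measure Prop :=
  toNNReal p • Measure.dirac (e ∈ (Sym2.diagSet : Set (Sym2 V))ᶜ) +
    toNNReal (σ p) • Measure.dirac False

instance (p : I) (e : Sym2 V) : IsProbabilityMeasure (edgeLaw p e) where
  measure_univ := by
    simp

theorem binomialRandom_eq_map_pi (p : I) :
    SimpleGraph.binomialRandom V p = (Measure.pi fun e : Sym2 V => edgeLaw p e).map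
      fun q => SimpleGraph.fromEdgeSet {e | q e} := by
  rw [SimpleGraph.binomialRandom_eq_map, setBernoulli_eq_map, Measure.map_map (by fun_prop)
    (by fun_prop), Measure.infinitePi_eq_pi]
  rfl

theorem binomialRandom_real_subset_edgeSet_le (p : I) (E : Finset (Sym2 V)) :
    (SimpleGraph.binomialRandom V p).real {G | (E : Set (Sym2 V)) ⊆ G.edgeSet} ≤
      (p : ℝ) ^ E.card := by
  classical
  have hmeas : Measurable fun q : Sym2 V → Prop => SimpleGraph.fromEdgeSet {e | q e} := by
    fun_prop
  rw [binomialRandom_eq_map_pi, map_measureReal_apply hmeas (Set.toFinite _).measurableSet]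
  have hsub : (fun q : Sym2 V → Prop => SimpleGraph.fromEdgeSet {e | q e}) ⁻¹'
      {G | (E : Set (Sym2 V)) ⊆ G.edgeSet} ⊆
      Set.univ.pi fun e => if e ∈ E then {True} else Set.univ := by
    intro q hq e _
    beta_reduce
    split_ifs with he
    · have := hq he
      rw [SimpleGraph.edgeSet_fromEdgeSet] at this
      simpa using this.1
    · trivial
  refine (measureReal_mono hsub).trans ?_
  rw [measureReal_def, Measure.pi_pi, ENNReal.toReal_prod, ← Finset.prod_const,
    ← Finset.prod_subset (Finset.subset_univ E)]
  · refine Finset.prod_le_prod (fun _ _ => ENNReal.toReal_nonneg) fun e he => ?_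
    rw [if_pos he]
    by_cases hd : e ∈ (Sym2.diagSet : Set (Sym2 V)) <;> simp [hd, p.2.1]
  · intro e _ he
    simp [he]

-- The degree is a sum of independent indicators over the pairs containing `v`, so the exponential
-- factorises over the edge coordinates.
open Classical in
theorem integral_exp_degree (p : I) (v : V) (l : ℝ) :
    ∫ G, Real.exp (-l * G.degree v) ∂SimpleGraph.binomialRandom V p =
      (1 - (1 - Real.exp (-l)) * p) ^ (Fintype.card V - 1) := by
  have hmeas : Measurable fun q : Sym2 V → Prop => SimpleGraph.fromEdgeSet {e | q e} := by
    fun_prop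
  let star : Finset (Sym2 V) := (⊤ : SimpleGraph V).incidenceFinset v
  have hstar : ∀ e, e ∈ star ↔ ¬ e.IsDiag ∧ v ∈ e := by
    intro e
    simp [star, SimpleGraph.mem_incidenceFinset, SimpleGraph.incidenceSet]
  have hcard : star.card = Fintype.card V - 1 := by
    simp [star, SimpleGraph.card_incidenceFinset_eq_degree]
  have hfun : ∀ (q : Sym2 V → Prop) (G : SimpleGraph V), G = SimpleGraph.fromEdgeSet {e | q e} →
      Real.exp (-l * G.degree v) = ∏ e, if e ∈ star ∧ q e then Real.exp (-l) else 1 := by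
    intro q G hG
    rw [Finset.prod_ite, Finset.prod_const, Finset.prod_const_one, mul_one, ← Real.exp_nat_mul,
      ← SimpleGraph.card_incidenceFinset_eq_degree, mul_comm]
    congr 4
    ext e
    simp only [SimpleGraph.mem_incidenceFinset, SimpleGraph.incidenceSet, hG,
      SimpleGraph.edgeSet_fromEdgeSet, Finset.mem_filter, Finset.mem_univ, true_and, hstar]
    simp
    tauto
  rw [binomialRandom_eq_map_pi, integral_map hmeas.aemeasurable (by
    exact (measurable_of_countable _).aestronglyMeasurable)]
  rw [integral_congr_ae (.of_forall fun q => hfun q _ rfl)]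
  rw [integral_fintype_prod_eq_prod (μ := fun e : Sym2 V => edgeLaw p e)
    (f := fun e (c : Prop) => if e ∈ star ∧ c then Real.exp (-l) else 1), ← hcard,
    ← Finset.prod_const, ← Finset.prod_subset (Finset.subset_univ star)]
  · refine Finset.prod_congr rfl fun e he => ?_
    have hd := ((hstar e).1 he).1
    rw [integral_add_measure .of_finite .of_finite, integral_smul_nnreal_measure,
      integral_smul_nnreal_measure, integral_dirac, integral_dirac]
    simp [he, hd, NNReal.smul_def]
    ring
  · intro e _ he
    simp [he]

open Classical in
/-- A Chernoff bound for the lower tail of the degree of a vertex. -/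
theorem binomialRandom_real_degree_lt_le {p : I} {v : V} (hn : 20 ≤ Fintype.card V) :
    (SimpleGraph.binomialRandom V p).real {G | 40 * (G.degree v : ℝ) < Fintype.card V * p} ≤
      Real.exp (-(3 / 4) * (Fintype.card V * p)) := by
  set n : ℝ := (Fintype.card V : ℝ) with hndef
  have hn' : (20 : ℝ) ≤ n := by rw [hndef]; exact_mod_cast hn
  have hp0 : (0 : ℝ) ≤ p := p.2.1
  -- Markov's inequality for `exp (-2 * deg)`: the threshold costs `exp (np / 20)` and the transform
  -- is at most `exp (-4np / 5)` once `n ≥ 20`, which leaves the exponent `-3np / 4`.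
  have hsub : {G : SimpleGraph V | 40 * (G.degree v : ℝ) < n * p} ⊆
      {G | Real.exp (-(n * p / 20)) ≤ Real.exp (-2 * G.degree v)} := by
    intro G hG
    simp only [Set.mem_ofPred_eq, Real.exp_le_exp] at hG ⊢
    linarith
  have hmarkov := mul_meas_ge_le_integral_of_nonneg (μ := SimpleGraph.binomialRandom V p)
    (f := fun G => Real.exp (-2 * G.degree v)) (.of_forall fun G => (Real.exp_pos _).le) .of_finite
    (Real.exp (-(n * p / 20)))
  rw [integral_exp_degree] at hmarkov
  have hexp : Real.exp (-2) ≤ 1 / 7 := by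
    have h1 : (2.7182818283 : ℝ) < Real.exp 1 := Real.exp_one_gt_d9
    have h2 : Real.exp 2 = Real.exp 1 * Real.exp 1 := by rw [← Real.exp_add]; norm_num
    rw [Real.exp_neg, one_div]
    apply inv_anti₀ (by norm_num)
    rw [h2]
    nlinarith
  have hbase : (1 - (1 - Real.exp (-2)) * (p : ℝ)) ^ (Fintype.card V - 1) ≤
      Real.exp (-(4 / 5) * (n * p)) := by
    have h1 : 1 - (1 - Real.exp (-2)) * (p : ℝ) ≤ Real.exp (-(6 / 7) * p) := by
      have := Real.add_one_le_exp (-(6 / 7) * (p : ℝ))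
      nlinarith
    have h0 : 0 ≤ 1 - (1 - Real.exp (-2)) * (p : ℝ) := by
      have := p.2.2
      have := Real.exp_pos (-2)
      nlinarith
    refine (pow_le_pow_left₀ h0 h1 _).trans ?_
    rw [← Real.exp_nat_mul, Real.exp_le_exp, Nat.cast_sub (by lia), ← hndef]
    push_cast
    nlinarith [mul_nonneg hp0 (show 0 ≤ n - 20 by linarith)]
  have h3 := (mul_le_mul_of_nonneg_left (measureReal_mono hsub) (Real.exp_pos _).le).trans
    (hmarkov.trans hbase)
  rw [mul_comm, ← le_div_iff₀ (Real.exp_pos _), ← Real.exp_sub] at h3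
  refine h3.trans (Real.exp_le_exp.2 ?_)
  linarith

end RandomGraph

/-! ### Counting witnesses -/

section Counting

variable {V : Type}

/-- Extend finite walks to sequences that stay at the end. -/
def extendWalks (m : ℕ) (w : Fin 3 × Bool → Fin (m + 1) → V) : Fin 3 × Bool → ℕ → V :=
  fun i j => w i ⟨min j m, by lia⟩

/-- Only indices up to `m` matter, so a union bound can run over the finite type of truncated walks.
-/
theorem exists_extendWalks {v : V} {m : ℕ} {N : Choices V} {w : Fin 3 × Bool → ℕ → V}
    (hw : IsWitness v m w) (hN : IsPolled N m w) :
    ∃ w' : Fin 3 × Bool → Fin (m + 1) → V,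
      IsWitness v m (extendWalks m w') ∧ IsPolled N m (extendWalks m w') := by
  have h : ∀ i, ∀ j ≤ m, extendWalks m (fun i (j : Fin (m + 1)) => w i j) i j = w i j :=
    fun i j hj => by simp [extendWalks, min_eq_left hj]
  have hpos : 1 ≤ m := by
    by_contra! hm
    obtain ⟨j, hj, hne⟩ := hw.distinct 0
    obtain rfl : j = 0 := by lia
    exact hne (by rw [hw.start, hw.start])
  refine ⟨fun i j => w i j, ⟨fun i => ?_, fun i => ?_, fun i j hij => ?_, fun i => ?_, fun i => ?_,
    fun i j hj => ?_, fun i j hj => ?_⟩, fun i j hj => ?_⟩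
  · rw [h _ _ (by lia), hw.start]
  · rw [h _ _ hpos, h _ _ hpos, hw.branch]
  · refine hw.injective ?_
    simpa only [h _ _ hpos] using hij
  · rw [h _ _ le_rfl, h _ _ le_rfl, hw.finish]
  · obtain ⟨j, hj, hne⟩ := hw.distinct i
    exact ⟨j, hj, by rwa [h _ _ hj, h _ _ hj]⟩
  · rw [h _ _ hj.le, h _ _ hj]
    exact hw.step i j hj
  · rw [h _ _ (by lia), h _ _ (by lia)]
    exact hw.ne i j hj
  · rw [h _ _ hj.le, h _ _ hj]
    exact hN i j hj

variable [Fintype V]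

-- Group the witnesses by the set `T` of visited vertices other than `v`. For `|T| = k` there are at
-- most `n ^ k` sets, at most `L ^ L` families on each (`L = 6(m + 1)`), and weight `(K / n) ^ (k +
-- 2)`; so each of the at most `L` values of `k` contributes order `n⁻²`.
open Classical in
theorem sum_witness_le [DecidableEq V] (v : V) (m : ℕ) {K : ℝ} (hK : 1 ≤ K) :
    ∑ w : Fin 3 × Bool → Fin (m + 1) → V with IsWitness v m (extendWalks m w),
        (K / Fintype.card V) ^ ((walkVertices m (extendWalks m w)).card + 1) ≤
      ((6 * (m + 1) : ℕ) : ℝ) * (6 * (m + 1) : ℕ) ^ (6 * (m + 1)) * K ^ (6 * (m + 1) + 1) /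
        (Fintype.card V : ℝ) ^ 2 := by
  set L := 6 * (m + 1) with hL
  set n := Fintype.card V with hn
  have hnpos : (0 : ℝ) < n := by
    rw [hn]; exact_mod_cast Fintype.card_pos_iff.2 ⟨v⟩
  set x : ℝ := K / n with hx
  have hx0 : 0 ≤ x := by positivity
  set S : (Fin 3 × Bool → Fin (m + 1) → V) → Finset V := fun w => walkVertices m (extendWalks m w)
  have hS : ∀ w i j, w i j ∈ S w := fun w i j => by
    have := mem_walkVertices (w := extendWalks m w) (i := i) (j := j) (show (j : ℕ) ≤ m by lia)
    simpa [extendWalks, min_eq_left (show (j : ℕ) ≤ m by lia)] using this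
  have hScard : ∀ w, (S w).card ≤ L := fun w => by
    refine Finset.card_image_le.trans ?_
    simp [hL]
  have hvS : ∀ w, IsWitness v m (extendWalks m w) → v ∈ S w := fun w hw => by
    have := mem_walkVertices (w := extendWalks m w) (i := (0, true)) (j := 0) (Nat.zero_le m)
    rwa [hw.start] at this
  rw [← Finset.sum_fiberwise_of_maps_to (g := fun w => (S w).erase v)
    (t := (Finset.univ.erase v).powerset)
    (fun w _ => Finset.mem_powerset.2 (Finset.erase_subset_erase _ (Finset.subset_univ _)))]
  have hfib : ∀ T ∈ (Finset.univ.erase v).powerset,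
      ∑ w ∈ (Finset.univ.filter fun w => IsWitness v m (extendWalks m w)) with (S w).erase v = T,
        x ^ ((S w).card + 1) ≤ if T.card < L then (L : ℝ) ^ L * x ^ (T.card + 2) else 0 := by
    intro T hT
    have hvT : v ∉ T := fun h => by simpa using Finset.mem_powerset.1 hT h
    have hST : ∀ w ∈ (Finset.univ.filter fun w => IsWitness v m (extendWalks m w)).filter
        (fun w => (S w).erase v = T), S w = insert v T := by
      intro w hw
      simp only [Finset.mem_filter, Finset.mem_univ, true_and] at hw
      rw [← hw.2, Finset.insert_erase (hvS w hw.1)]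
    split_ifs with hTL
    · have hval : ∀ w ∈ (Finset.univ.filter fun w => IsWitness v m (extendWalks m w)).filter
          (fun w => (S w).erase v = T), x ^ ((S w).card + 1) = x ^ (T.card + 2) := by
        intro w hw
        rw [hST w hw, Finset.card_insert_of_notMem hvT]
      rw [Finset.sum_congr rfl hval, Finset.sum_const, nsmul_eq_mul]
      refine mul_le_mul_of_nonneg_right ?_ (by positivity)
      have hsub : (Finset.univ.filter fun w => IsWitness v m (extendWalks m w)).filter
          (fun w => (S w).erase v = T) ⊆
          Fintype.piFinset fun _ => Fintype.piFinset fun _ => insert v T := by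
        intro w hw
        simp only [Fintype.mem_piFinset]
        intro i j
        rw [← hST w hw]
        exact hS w i j
      have hc := Finset.card_le_card hsub
      simp only [Fintype.card_piFinset, Finset.prod_const, Finset.card_univ, Fintype.card_fin,
        Fintype.card_prod, Fintype.card_bool, Finset.card_insert_of_notMem hvT] at hc
      rw [← pow_mul] at hc
      have hexp : (m + 1) * (3 * 2) = L := by lia
      rw [hexp] at hc
      have := hc.trans (Nat.pow_le_pow_left (show T.card + 1 ≤ L by lia) L)
      exact_mod_cast this
    · rw [Finset.filter_eq_empty_iff.2, Finset.sum_empty]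
      intro w hw hwT
      have h1 := hST w (Finset.mem_filter.2 ⟨hw, hwT⟩)
      have h2 := hScard w
      rw [h1, Finset.card_insert_of_notMem hvT] at h2
      lia
  refine (Finset.sum_le_sum hfib).trans ?_
  rw [Finset.sum_powerset_apply_card
    (fun k => if k < L then (L : ℝ) ^ L * x ^ (k + 2) else 0)]
  have hterm : ∀ k ∈ Finset.range ((Finset.univ.erase v).card + 1),
      ((Finset.univ.erase v).card.choose k) •
        (if k < L then (L : ℝ) ^ L * x ^ (k + 2) else 0) ≤
      if k < L then (L : ℝ) ^ L * K ^ (L + 1) / n ^ 2 else 0 := by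
    intro k _
    split_ifs with hk
    · rw [nsmul_eq_mul]
      have h1 : ((Finset.univ.erase v).card.choose k : ℝ) ≤ (n : ℝ) ^ k := by
        have : (Finset.univ.erase v).card.choose k ≤ n ^ k :=
          (Nat.choose_le_pow _ _).trans (Nat.pow_le_pow_left
            (Finset.card_le_univ _) k)
        exact_mod_cast this
      have h2 : K ^ (k + 2) ≤ K ^ (L + 1) := pow_le_pow_right₀ hK (by lia)
      calc _ ≤ (n : ℝ) ^ k * ((L : ℝ) ^ L * x ^ (k + 2)) := by gcongr
        _ = (L : ℝ) ^ L * K ^ (k + 2) / n ^ 2 := by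
            rw [hx, div_pow, pow_add (n : ℝ) k 2]
            field_simp
        _ ≤ _ := by gcongr
    · simp
  refine (Finset.sum_le_sum hterm).trans ?_
  rw [← Finset.sum_filter, Finset.sum_const, nsmul_eq_mul, mul_assoc (L : ℝ), mul_div_assoc (L : ℝ)]
  refine mul_le_mul_of_nonneg_right ?_ (by positivity)
  have : ((Finset.range ((Finset.univ.erase v).card + 1)).filter (· < L)).card ≤ L := by
    refine (Finset.card_le_card (t := Finset.range L) fun k hk => ?_).trans (by simp)
    simp only [Finset.mem_filter] at hk
    simpa using hk.2
  exact_mod_cast this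

end Counting

/-! ### Truncating the polling choices to finitely many times -/

section Truncation

variable {V : Type}

/-- The polls made up to time `t`. -/
def restrictChoices (t : ℕ) (N : Choices V) : Fin t × V → Finset V := fun i => N (i.1, i.2)

/-- Polling choices with empty polls after time `t`. -/
def extendChoices (t : ℕ) (M : Fin t × V → Finset V) : Choices V :=
  fun i => if h : i.1 < t then M (⟨i.1, h⟩, i.2) else ∅

theorem extendChoices_restrictChoices {t s : ℕ} (N : Choices V) (v : V) (hs : s < t) :
    extendChoices t (restrictChoices t N) (s, v) = N (s, v) := by
  simp [extendChoices, restrictChoices, hs]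

theorem measurable_restrictChoices (t : ℕ) :
    Measurable (restrictChoices t : Choices V → Fin t × V → Finset V) :=
  measurable_pi_lambda _ fun _ => measurable_pi_apply _

variable [Fintype V]

theorem run_congr {G : SimpleGraph V} {k : ℕ} {x : Colouring V} {N N' : Choices V} {t : ℕ}
    (h : ∀ s < t, ∀ v, N (s, v) = N' (s, v)) : run G k x N t = run G k x N' t := by
  induction t with
  | zero => rfl
  | succ t ih =>
    funext v
    simp only [run, ih fun s hs => h s (by lia), h t (by lia) v]

end Truncation

/-! ### Conditioning on the graph and on the polls -/

section Trial

variable {V : Type} [Fintype V]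

instance (G : SimpleGraph V) (k : ℕ) (α : I) : IsProbabilityMeasure (runLaw G k α) := by
  unfold runLaw
  infer_instance

instance (n k : ℕ) (α : I) : IsMarkovKernel (Kernel.ofFunOfCountable
    fun G : SimpleGraph (Fin n) => runLaw G k α) :=
  ⟨fun G => inferInstanceAs (IsProbabilityMeasure (runLaw G k α))⟩

instance (n k : ℕ) (p α : I) : IsProbabilityMeasure (trialLaw n k p α) := by
  unfold trialLaw
  infer_instance

/-- There are finitely many graphs, so replacing each slice of `S` by a measurable hull gives a
measurable superset with slices of the same measure. Thus no measurability of `S` is required. -/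
theorem trialLaw_real_le {n k : ℕ} {p α : I}
    {S : Set (SimpleGraph (Fin n) × Colouring (Fin n) × Choices (Fin n))}
    {f : SimpleGraph (Fin n) → ℝ} (hf : ∀ G, (runLaw G k α).real {y | (G, y) ∈ S} ≤ f G) :
    (trialLaw n k p α).real S ≤ ∫ G, f G ∂SimpleGraph.binomialRandom (Fin n) p := by
  let S' : Set (SimpleGraph (Fin n) × Colouring (Fin n) × Choices (Fin n)) :=
    ⋃ G, {G} ×ˢ toMeasurable (runLaw G k α) {y | (G, y) ∈ S}
  have hS' : MeasurableSet S' :=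
    .iUnion fun G => (measurableSet_singleton G).prod (measurableSet_toMeasurable _ _)
  have hsub : S ⊆ S' := fun ω hω => Set.mem_iUnion.2
    ⟨ω.1, rfl, subset_toMeasurable (runLaw ω.1 k α) {y | (ω.1, y) ∈ S} hω⟩
  have hslice : ∀ G, Prod.mk G ⁻¹' S' = toMeasurable (runLaw G k α) {y | (G, y) ∈ S} := by
    intro G
    ext y
    simp [S']
  have hf0 : ∀ G, 0 ≤ f G := fun G => measureReal_nonneg.trans (hf G)
  have hle : trialLaw n k p α S ≤
      ENNReal.ofReal (∫ G, f G ∂SimpleGraph.binomialRandom (Fin n) p) := by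
    rw [ofReal_integral_eq_lintegral_ofReal .of_finite (.of_forall hf0)]
    refine (measure_mono hsub).trans ?_
    rw [trialLaw, Measure.compProd_apply hS']
    refine lintegral_mono fun G => ?_
    rw [hslice]
    change runLaw G k α (toMeasurable (runLaw G k α) {y | (G, y) ∈ S}) ≤ _
    rw [measure_toMeasurable, ← ofReal_measureReal]
    exact ENNReal.ofReal_le_ofReal (hf G)
  exact ENNReal.toReal_le_of_le_ofReal (integral_nonneg hf0) hle

theorem trialLaw_real_le_const {n k : ℕ} {p α : I}
    {S : Set (SimpleGraph (Fin n) × Colouring (Fin n) × Choices (Fin n))}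
    {c : ℝ} (hc : ∀ G, (runLaw G k α).real {y | (G, y) ∈ S} ≤ c) :
    (trialLaw n k p α).real S ≤ c := by
  simpa using trialLaw_real_le (p := p) hc

theorem runLaw_real_fst (G : SimpleGraph V) (k : ℕ) (α : I) (B : Set (Colouring V)) :
    (runLaw G k α).real {y | y.1 ∈ B} = (colourLaw V α).real B := by
  have : {y : Colouring V × Choices V | y.1 ∈ B} = B ×ˢ Set.univ := by ext; simp
  rw [this, runLaw, measureReal_prod_prod]
  simp

theorem runLaw_real_snd (G : SimpleGraph V) (k : ℕ) (α : I) (B : Set (Choices V)) :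
    (runLaw G k α).real {y | y.2 ∈ B} = (choicesLaw G k).real B := by
  have : {y : Colouring V × Choices V | y.2 ∈ B} = Set.univ ×ˢ B := by ext; simp
  rw [this, runLaw, measureReal_prod_prod]
  simp

/-- The event that some good branch at `v` is red, for polling choices truncated after
time `t + 1`. -/
def goodBranchRed (ν t : ℕ) (v : V) : Set (Colouring V × (Fin (t + 1) × V → Finset V)) :=
  {y | (∀ s < t + 1, ∀ u, (extendChoices (t + 1) y.2 (s, u)).card = 2 * ν + 1) ∧
    ∃ u ∈ extendChoices (t + 1) y.2 (t, v), IsGood (extendChoices (t + 1) y.2) ν t v u ∧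
      treeRed (extendChoices (t + 1) y.2) ν t v u y.1}

theorem colourLaw_real_goodBranchRed_le {α : I} {ν t : ℕ} {v : V} {c : ℝ} (hc₀ : 0 ≤ c)
    (hc : (binomialTail ν)^[t] α ≤ c) (M : Fin (t + 1) × V → Finset V) :
    (colourLaw V α).real {x | (x, M) ∈ goodBranchRed ν t v} ≤ (2 * ν + 1 : ℕ) * c := by
  classical
  set N := extendChoices (t + 1) M with hN
  by_cases hcard : ∀ s < t + 1, ∀ u, (N (s, u)).card = 2 * ν + 1
  · have hsub : {x | (x, M) ∈ goodBranchRed ν t v} ⊆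
        ⋃ u ∈ (N (t, v)).filter (fun u => IsGood N ν t v u), {x | treeRed N ν t v u x} := by
      rintro x ⟨_, u, hu, hg, hr⟩
      simp only [Set.mem_iUnion, Finset.mem_filter]
      exact ⟨u, ⟨hu, hg⟩, hr⟩
    refine (measureReal_mono hsub (measure_ne_top _ _)).trans
      ((measureReal_biUnion_finset_le _ _).trans ?_)
    have hone : ∀ u ∈ (N (t, v)).filter (fun u => IsGood N ν t v u),
        (colourLaw V α).real {x | treeRed N ν t v u x} ≤ c := by
      intro u hu
      rw [colourLaw_real_treeRed (fun s hs => hcard s (by lia)) (Finset.mem_filter.1 hu).2]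
      exact hc
    refine (Finset.sum_le_card_nsmul _ _ _ hone).trans ?_
    rw [nsmul_eq_mul]
    refine mul_le_mul_of_nonneg_right ?_ hc₀
    have := (Finset.card_filter_le (N (t, v)) fun u => IsGood N ν t v u).trans
      (hcard t (by lia) v).le
    exact_mod_cast this
  · have : {x | (x, M) ∈ goodBranchRed ν t v} = ∅ := by
      ext x
      simp only [goodBranchRed, Set.mem_ofPred_eq, Set.mem_empty_iff_false, iff_false]
      exact fun h => hcard h.1
    rw [this, measureReal_empty]
    positivity

/-- Tonelli with the polls fixed first: for each choice of polls only the initial colours are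
random. Truncation makes the event the preimage of a set in a discrete space, hence measurable. -/
theorem runLaw_real_goodBranchRed_le {G : SimpleGraph V} {k : ℕ} {α : I} {ν t : ℕ} {v : V} {c : ℝ}
    (hc₀ : 0 ≤ c) (hc : (binomialTail ν)^[t] α ≤ c) :
    (runLaw G k α).real {y | (y.1, restrictChoices (t + 1) y.2) ∈ goodBranchRed ν t v} ≤
      (2 * ν + 1 : ℕ) * c := by
  have hmeas : MeasurableSet
      {y : Colouring V × Choices V | (y.1, restrictChoices (t + 1) y.2) ∈ goodBranchRed ν t v} := by
    have h1 : Measurable fun y : Colouring V × Choices V =>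
        (y.1, restrictChoices (t + 1) y.2) :=
      measurable_fst.prodMk ((measurable_restrictChoices _).comp measurable_snd)
    exact h1 .of_discrete
  have hle : runLaw G k α {y | (y.1, restrictChoices (t + 1) y.2) ∈ goodBranchRed ν t v} ≤
      ENNReal.ofReal ((2 * ν + 1 : ℕ) * c) := by
    rw [runLaw, Measure.prod_apply_symm hmeas]
    refine (lintegral_mono (g := fun _ => ENNReal.ofReal ((2 * ν + 1 : ℕ) * c)) fun N => ?_).trans
      (by simp)
    rw [← ofReal_measureReal]
    exact ENNReal.ofReal_le_ofReal
      (colourLaw_real_goodBranchRed_le hc₀ hc (restrictChoices (t + 1) N))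
  exact ENNReal.toReal_le_of_le_ofReal (by positivity) hle

end Trial

/-! ### The failure probability at fixed `n` -/

section FiniteBound

variable {n : ℕ}

open Classical in
/-- All degrees are at least a constant fraction of the expected degree. -/
def HasLargeDegrees (p : I) (G : SimpleGraph (Fin n)) : Prop :=
  ∀ v, n * (p : ℝ) ≤ 40 * G.degree v

theorem trialLaw_real_not_hasLargeDegrees_le {k : ℕ} {p α : I} (hn : 20 ≤ n) :
    (trialLaw n k p α).real {ω | ¬ HasLargeDegrees p ω.1} ≤
      n * Real.exp (-(3 / 4) * (n * p)) := by
  classical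
  let D : Fin n → Set (SimpleGraph (Fin n)) := fun v => {G | 40 * (G.degree v : ℝ) < n * p}
  have h := trialLaw_real_le (k := k) (α := α) (p := p)
    (S := {ω : SimpleGraph (Fin n) × Colouring (Fin n) × Choices (Fin n) | ¬ HasLargeDegrees p ω.1})
    (f := fun G => ∑ v, (D v).indicator (fun _ => (1 : ℝ)) G) ?_
  · refine h.trans ?_
    rw [integral_finsetSum _ fun _ _ => .of_finite]
    have hv : ∀ v ∈ (Finset.univ : Finset (Fin n)),
        ∫ G, (D v).indicator (fun _ => (1 : ℝ)) G ∂SimpleGraph.binomialRandom (Fin n) p ≤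
          Real.exp (-(3 / 4) * (n * p)) := by
      intro v _
      rw [integral_indicator_const _ (Set.toFinite _).measurableSet, smul_eq_mul, mul_one]
      have := binomialRandom_real_degree_lt_le (p := p) (v := v) (by simpa using hn)
      simpa only [Fintype.card_fin] using this
    refine (Finset.sum_le_card_nsmul _ _ _ hv).trans ?_
    simp
  · intro G
    by_cases hG : HasLargeDegrees p G
    · simp only [hG, Set.mem_ofPred_eq, not_true_eq_false, Set.ofPred_false, measureReal_empty]
      exact Finset.sum_nonneg fun v _ => Set.indicator_nonneg (fun _ _ => zero_le_one) _
    · refine measureReal_le_one.trans ?_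
      have hG' := hG
      simp only [HasLargeDegrees, not_forall, not_le] at hG'
      obtain ⟨v, hv⟩ := hG'
      refine le_trans ?_ (Finset.single_le_sum (f := fun v => (D v).indicator (fun _ => (1 : ℝ)) G)
        (fun v _ => Set.indicator_nonneg (fun _ _ => zero_le_one) _) (Finset.mem_univ v))
      rw [Set.indicator_of_mem (show G ∈ D v from hv)]

open Classical in
theorem HasLargeDegrees.le_degree {p : I} {G : SimpleGraph (Fin n)} (hG : HasLargeDegrees p G)
    {k : ℕ} (hk : 40 * (k : ℝ) ≤ n * p) (v : Fin n) : k ≤ G.degree v := by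
  have := hk.trans (hG v)
  have h : (k : ℝ) ≤ G.degree v := by linarith
  exact_mod_cast h

/-- Under the degree bound a prescribed poll has probability at most `r = 40k / (np)`, and the edge
is present with probability `p`. In the product `p` cancels, so each distinct edge costs `40k / n`,
and the surplus edge leaves `n⁻²` per root. -/
theorem trialLaw_real_isWitness_le {k : ℕ} (hk : Odd k) {p α : I} (hnp : 40 * (k : ℝ) ≤ n * p)
    (m : ℕ) :
    (trialLaw n k p α).real {ω | HasLargeDegrees p ω.1 ∧ ∃ v w, IsWitness v m (extendWalks m w) ∧
        IsPolled ω.2.2 m (extendWalks m w)} ≤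
      n * (((6 * (m + 1) : ℕ) : ℝ) * (6 * (m + 1) : ℕ) ^ (6 * (m + 1)) *
        (40 * k) ^ (6 * (m + 1) + 1) / (n : ℝ) ^ 2) := by
  classical
  have hkpos : (1 : ℝ) ≤ k := by exact_mod_cast hk.pos
  have hnp0 : 0 < n * (p : ℝ) := by linarith
  have hn0 : (0 : ℝ) < n := by
    rcases (Nat.cast_nonneg (α := ℝ) n).eq_or_lt with h | h
    · rw [← h] at hnp0; simp at hnp0
    · exact h
  have hp0 : (0 : ℝ) < p := pos_of_mul_pos_right hnp0 hn0.le
  set r : ℝ := 40 * k / (n * p) with hr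
  have hr0 : 0 ≤ r := by positivity
  have hr1 : r ≤ 1 := (div_le_one hnp0).2 hnp
  have hrp : r * p = 40 * k / n := by rw [hr]; field_simp
  have hrp1 : 40 * (k : ℝ) / n ≤ 1 := by
    rw [← hrp]; exact mul_le_one₀ hr1 p.2.1 p.2.2
  let E : (Fin 3 × Bool → Fin (m + 1) → Fin n) → Finset (Sym2 (Fin n)) :=
    fun w => walkEdges m (extendWalks m w)
  let A : (Fin 3 × Bool → Fin (m + 1) → Fin n) → Set (SimpleGraph (Fin n)) :=
    fun w => {G | (E w : Set (Sym2 (Fin n))) ⊆ G.edgeSet}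
  let W : Fin n → Finset (Fin 3 × Bool → Fin (m + 1) → Fin n) :=
    fun v => Finset.univ.filter fun w => IsWitness v m (extendWalks m w)
  refine (trialLaw_real_le (f := fun G => ∑ v, ∑ w ∈ W v,
    (A w).indicator (fun _ => r ^ (E w).card) G) ?_).trans ?_
  · intro G
    have hnn : 0 ≤ ∑ v, ∑ w ∈ W v, (A w).indicator (fun _ => r ^ (E w).card) G :=
      Finset.sum_nonneg fun v _ => Finset.sum_nonneg fun w _ =>
        Set.indicator_nonneg (fun _ _ => by positivity) _
    by_cases hG : HasLargeDegrees p G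
    · have hsub : {y : Colouring (Fin n) × Choices (Fin n) |
          (G, y) ∈ {ω : SimpleGraph (Fin n) × Colouring (Fin n) × Choices (Fin n) |
            HasLargeDegrees p ω.1 ∧ ∃ v w, IsWitness v m (extendWalks m w) ∧
              IsPolled ω.2.2 m (extendWalks m w)}} ⊆
          ⋃ v ∈ (Finset.univ : Finset (Fin n)), ⋃ w ∈ W v,
            {y | y.2 ∈ {N | IsPolled N m (extendWalks m w)}} := by
        rintro y ⟨_, v, w, hw, hy⟩
        simp only [Set.mem_iUnion]
        exact ⟨v, Finset.mem_univ v, w, by simpa [W] using hw, hy⟩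
      refine (measureReal_mono hsub (measure_ne_top _ _)).trans
        ((measureReal_biUnion_finset_le _ _).trans (Finset.sum_le_sum fun v _ =>
          (measureReal_biUnion_finset_le _ _).trans (Finset.sum_le_sum fun w _ => ?_)))
      rw [runLaw_real_snd]
      refine (choicesLaw_real_isPolled_le hk (hG.le_degree hnp) (r := r) (fun v => ?_) hr1 hr0 m
        (extendWalks m w)).trans (le_of_eq ?_)
      · rw [hr, div_mul_eq_mul_div, le_div_iff₀ hnp0]
        have := hG v
        nlinarith
      · simp [Set.indicator, A, E]
    · simpa [hG] using hnn
  · rw [integral_finsetSum _ fun _ _ => .of_finite]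
    have hv : ∀ v ∈ (Finset.univ : Finset (Fin n)),
        ∫ G, ∑ w ∈ W v, (A w).indicator (fun _ => r ^ (E w).card) G
            ∂SimpleGraph.binomialRandom (Fin n) p ≤
          ((6 * (m + 1) : ℕ) : ℝ) * (6 * (m + 1) : ℕ) ^ (6 * (m + 1)) *
            (40 * k) ^ (6 * (m + 1) + 1) / (n : ℝ) ^ 2 := by
      intro v _
      rw [integral_finsetSum _ fun _ _ => .of_finite]
      have hcount := sum_witness_le v m (K := 40 * (k : ℝ)) (by linarith)
      simp only [Fintype.card_fin] at hcount
      refine le_trans (Finset.sum_le_sum fun w hw => ?_) hcount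
      rw [integral_indicator_const _ (Set.toFinite _).measurableSet, smul_eq_mul]
      have h1 := binomialRandom_real_subset_edgeSet_le p (E w)
      have h2 := (Finset.mem_filter.1 hw).2.card_add_one_le
      calc (SimpleGraph.binomialRandom (Fin n) p).real (A w) * r ^ (E w).card
          ≤ (p : ℝ) ^ (E w).card * r ^ (E w).card :=
            mul_le_mul_of_nonneg_right h1 (by positivity)
        _ = (40 * (k : ℝ) / n) ^ (E w).card := by rw [← mul_pow, mul_comm, hrp]
        _ ≤ _ := pow_le_pow_of_le_one (by positivity) hrp1 h2
    refine (Finset.sum_le_card_nsmul _ _ _ hv).trans ?_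
    simp

theorem trialLaw_real_exists_notMem_polls (k : ℕ) (p α : I) :
    (trialLaw n k p α).real {ω | ¬ ∀ s v, ω.2.2 (s, v) ∈ polls ω.1 k v} ≤ 0 := by
  refine trialLaw_real_le_const fun G => ?_
  have := runLaw_real_snd G k α {N | ¬ ∀ s v, N (s, v) ∈ polls G k v}
  refine (this.trans ?_).le
  rw [measureReal_eq_zero_iff]
  exact ae_iff.1 (ae_mem_polls G k)

-- The deterministic core: a vertex still red at time `t + 1` has either three bad branches, hence a
-- polled witness, or a red good branch; both are excluded.
open Classical in
theorem mem_majorityConsensusBy {ν t : ℕ} (hν : 2 ≤ ν) {T : ℝ} (ht : ((t + 1 : ℕ) : ℝ) ≤ T)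
    {G : SimpleGraph (Fin n)} {x : Colouring (Fin n)} {N : Choices (Fin n)}
    (hx : IsMajority x true) (hdeg : ∀ v, 2 * ν + 1 ≤ G.degree v)
    (hN : ∀ s v, N (s, v) ∈ polls G (2 * ν + 1) v)
    (hwit : ¬ ∃ v w, IsWitness v (t + 1) (extendWalks (t + 1) w) ∧
      IsPolled N (t + 1) (extendWalks (t + 1) w))
    (hred : ∀ v, (x, restrictChoices (t + 1) N) ∉ goodBranchRed ν t v) :
    (G, x, N) ∈ majorityConsensusBy (2 * ν + 1) T := by
  have hk : ∀ v, pollSize (2 * ν + 1) (G.degree v) = 2 * ν + 1 := fun v =>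
    pollSize_eq ⟨ν, rfl⟩ (hdeg v)
  refine ⟨true, hx, t + 1, ht, fun v => ?_⟩
  by_contra hv
  rw [Bool.not_eq_true] at hv
  set N' := extendChoices (t + 1) (restrictChoices (t + 1) N) with hN'
  have hNN' : ∀ s < t + 1, ∀ v, N (s, v) = N' (s, v) := fun s hs v =>
    (extendChoices_restrictChoices N v hs).symm
  have hmem : ∀ s < t + 1, ∀ v, N' (s, v) ∈ polls G (2 * ν + 1) v := fun s hs v =>
    hNN' s hs v ▸ hN s v
  have hcard : ∀ s < t + 1, ∀ v, (N' (s, v)).card = 2 * ν + 1 := fun s hs v => by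
    have := hmem s hs v
    rw [polls, hk, Finset.mem_powersetCard] at this
    exact this.2
  have hself : ∀ s < t + 1, ∀ v, v ∉ N' (s, v) := fun s hs v hvN => by
    have := hmem s hs v
    rw [polls, Finset.mem_powersetCard] at this
    simpa using this.1 hvN
  change run G (2 * ν + 1) x N (t + 1) v = false at hv
  rw [run_congr hNN'] at hv
  by_cases hbad : ((N' (t, v)).filter fun u => ¬ IsGood N' ν t v u).card ≤ 2
  · obtain ⟨u, hu, hg, hr⟩ := exists_isGood_treeRed hν hk
      (fun v => by have := hdeg v; lia) hcard hbad hv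
    exact hred v ⟨hcard, u, hu, hg, hr⟩
  · obtain ⟨w, hw, hp⟩ := exists_isWitness hself (not_le.1 hbad)
    have hp' : IsPolled N (t + 1) w := fun i j hj => by
      rw [hNN' _ (by lia)]
      exact hp i j hj
    obtain ⟨w', hw', hp''⟩ := exists_extendWalks hw hp'
    exact hwit ⟨v, w', hw', hp''⟩

/-- A bound for the failure probability at given `n`. -/
theorem one_sub_trialLaw_real_majorityConsensusBy_le {ν t : ℕ} (hν : 2 ≤ ν) {p α : I}
    (hn : 20 ≤ n) (hα : (α : ℝ) ≤ 1 / 2) (hnp : 40 * ((2 * ν + 1 : ℕ) : ℝ) ≤ n * p) {T : ℝ}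
    (ht : ((t + 1 : ℕ) : ℝ) ≤ T) {c : ℝ} (hc₀ : 0 ≤ c) (hc : (binomialTail ν)^[t] α ≤ c) :
    1 - (trialLaw n (2 * ν + 1) p α).real (majorityConsensusBy (2 * ν + 1) T) ≤
      (2 * Real.sqrt (α * (1 - α))) ^ n + n * Real.exp (-(3 / 4) * (n * p)) +
        n * (((6 * (t + 2) : ℕ) : ℝ) * (6 * (t + 2) : ℕ) ^ (6 * (t + 2)) *
          (40 * (2 * ν + 1 : ℕ)) ^ (6 * (t + 2) + 1) / (n : ℝ) ^ 2) +
        n * ((2 * ν + 1 : ℕ) * c) := by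
  classical
  set μ := trialLaw n (2 * ν + 1) p α
  set B₀ : Set (SimpleGraph (Fin n) × Colouring (Fin n) × Choices (Fin n)) :=
    {ω | ¬ IsMajority ω.2.1 true}
  set B₁ : Set (SimpleGraph (Fin n) × Colouring (Fin n) × Choices (Fin n)) :=
    {ω | ¬ HasLargeDegrees p ω.1}
  set B₂ : Set (SimpleGraph (Fin n) × Colouring (Fin n) × Choices (Fin n)) :=
    {ω | HasLargeDegrees p ω.1 ∧ ∃ v w, IsWitness v (t + 1) (extendWalks (t + 1) w) ∧
        IsPolled ω.2.2 (t + 1) (extendWalks (t + 1) w)}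
  set B₃ : Set (SimpleGraph (Fin n) × Colouring (Fin n) × Choices (Fin n)) :=
    ⋃ v ∈ (Finset.univ : Finset (Fin n)),
      {ω | (ω.2.1, restrictChoices (t + 1) ω.2.2) ∈ goodBranchRed ν t v}
  set B₄ : Set (SimpleGraph (Fin n) × Colouring (Fin n) × Choices (Fin n)) :=
    {ω | ¬ ∀ s v, ω.2.2 (s, v) ∈ polls ω.1 (2 * ν + 1) v}
  have h₀ : μ.real B₀ ≤ (2 * Real.sqrt (α * (1 - α))) ^ n := by
    refine trialLaw_real_le_const fun G => ?_
    have := (runLaw_real_fst G (2 * ν + 1) α {x | ¬ IsMajority x true}).le.trans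
      (colourLaw_real_not_isMajority hα)
    rw [Fintype.card_fin] at this
    exact this
  have h₁ : μ.real B₁ ≤ n * Real.exp (-(3 / 4) * (n * p)) :=
    trialLaw_real_not_hasLargeDegrees_le hn
  have h₂ := trialLaw_real_isWitness_le (n := n) ⟨ν, rfl⟩ (α := α) hnp (t + 1)
  have h₃ : μ.real B₃ ≤ n * ((2 * ν + 1 : ℕ) * c) := by
    refine (measureReal_biUnion_finset_le _ _).trans ((Finset.sum_le_card_nsmul _ _
      ((2 * ν + 1 : ℕ) * c) fun v _ => ?_).trans (by simp))
    exact trialLaw_real_le_const fun G => runLaw_real_goodBranchRed_le hc₀ hc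
  have h₄ : μ.real B₄ ≤ 0 := trialLaw_real_exists_notMem_polls _ _ _
  -- Covering the whole space and using subadditivity avoids having to show that the consensus event
  -- is measurable.
  have hcover : (Set.univ : Set (SimpleGraph (Fin n) × Colouring (Fin n) × Choices (Fin n))) ⊆
      majorityConsensusBy (2 * ν + 1) T ∪ (B₀ ∪ (B₁ ∪ (B₂ ∪ (B₃ ∪ B₄)))) := by
    rintro ⟨G, x, N⟩ -
    by_contra hω
    simp only [Set.mem_union, not_or] at hω
    obtain ⟨hE, hb₀, hb₁, hb₂, hb₃, hb₄⟩ := hω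
    have hG : HasLargeDegrees p G := not_not.1 hb₁
    refine hE (mem_majorityConsensusBy hν ht (not_not.1 hb₀) (hG.le_degree hnp) (not_not.1 hb₄)
      (fun h => hb₂ ⟨hG, h⟩) fun v hv => hb₃ ?_)
    simp only [B₃, Set.mem_iUnion]
    exact ⟨v, Finset.mem_univ v, hv⟩
  have h5 := measureReal_mono (μ := μ) hcover
  rw [probReal_univ] at h5
  have u1 := measureReal_union_le (μ := μ) (majorityConsensusBy (2 * ν + 1) T)
    (B₀ ∪ (B₁ ∪ (B₂ ∪ (B₃ ∪ B₄))))
  have u2 := measureReal_union_le (μ := μ) B₀ (B₁ ∪ (B₂ ∪ (B₃ ∪ B₄)))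
  have u3 := measureReal_union_le (μ := μ) B₁ (B₂ ∪ (B₃ ∪ B₄))
  have u4 := measureReal_union_le (μ := μ) B₂ (B₃ ∪ B₄)
  have u5 := measureReal_union_le (μ := μ) B₃ B₄
  change μ.real B₂ ≤ _ at h₂
  linarith

end FiniteBound

/-! ### Asymptotic estimates in `u = log n` -/

section Asymptotics

open Filter

theorem eventually_mul_log_sq_le (C : ℝ) : ∀ᶠ u : ℝ in atTop, C * Real.log u ^ 2 ≤ u / 2 := by
  have h := (Asymptotics.isLittleO_iff.1 (Real.isLittleO_pow_log_id_atTop (n := 2)))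
    (show (0 : ℝ) < 1 / (2 * (|C| + 1)) by positivity)
  filter_upwards [h, eventually_ge_atTop 0] with u hu hu0
  rw [Real.norm_of_nonneg (by positivity), id, Real.norm_of_nonneg hu0] at hu
  have hC : C ≤ |C| + 1 := (le_abs_self C).trans (by linarith)
  calc C * Real.log u ^ 2 ≤ (|C| + 1) * Real.log u ^ 2 := by gcongr
    _ ≤ (|C| + 1) * (1 / (2 * (|C| + 1)) * u) := by gcongr
    _ = u / 2 := by field_simp

/-- A power whose base and exponent are of order `log log n` is smaller than `√n`. -/
theorem eventually_pow_le_sqrt (a K : ℝ) (hK : 1 ≤ K) : ∀ᶠ u : ℝ in atTop, ∀ t : ℕ,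
    (t : ℝ) ≤ a * Real.log u →
      ((6 * (t + 2) : ℕ) : ℝ) * (6 * (t + 2) : ℕ) ^ (6 * (t + 2)) * K ^ (6 * (t + 2) + 1) ≤
        Real.exp (u / 2) := by
  filter_upwards [eventually_mul_log_sq_le (K * (6 * |a| + 13) ^ 2),
    Real.tendsto_log_atTop.eventually_ge_atTop 1] with u hu hlog t ht
  set L : ℕ := 6 * (t + 2) with hL
  have hLle : (L : ℝ) + 1 ≤ (6 * |a| + 13) * Real.log u := by
    have h1 : (t : ℝ) ≤ |a| * Real.log u :=
      ht.trans (mul_le_mul_of_nonneg_right (le_abs_self a) (by linarith))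
    rw [hL]
    push_cast
    nlinarith
  have hpos : (0 : ℝ) ≤ L := Nat.cast_nonneg L
  have h2 : (L : ℝ) * K ≤ Real.exp (L * K) := (Real.add_one_le_exp (L * K)).trans' (by linarith)
  -- The crude bound `y ≤ exp y` suffices: it leaves an exponent of order `(log u) ^ 2`, far below
  -- `u / 2`.
  calc (L : ℝ) * (L : ℝ) ^ L * K ^ (L + 1) = (L * K) ^ (L + 1) := by
        rw [mul_pow, pow_succ' (L : ℝ)]
    _ ≤ Real.exp (L * K) ^ (L + 1) := by gcongr
    _ = Real.exp (K * (L * (L + 1))) := by rw [← Real.exp_nat_mul]; push_cast; ring_nf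
    _ ≤ Real.exp (u / 2) := Real.exp_le_exp.2 (le_trans ?_ hu)
  rw [mul_assoc, ← mul_pow]
  refine mul_le_mul_of_nonneg_left ?_ (by linarith)
  nlinarith

theorem eventually_mul_le_rpow {δ : ℝ} (hδ : 0 < δ) (C : ℝ) :
    ∀ᶠ u : ℝ in atTop, C * u ≤ u ^ (1 + δ) := by
  filter_upwards [(tendsto_rpow_atTop hδ).eventually_ge_atTop C, eventually_gt_atTop 0]
    with u hu hu0
  rw [Real.rpow_add hu0, Real.rpow_one, mul_comm]
  gcongr

theorem eventually_natCast_mul_pow_le_one {q : ℝ} (hq₀ : 0 ≤ q) (hq₁ : q < 1) :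
    ∀ᶠ n : ℕ in atTop, (n : ℝ) * q ^ n ≤ 1 := by
  have h := tendsto_pow_const_mul_const_pow_of_abs_lt_one 1 (r := q)
    (by rwa [abs_of_nonneg hq₀])
  filter_upwards [h.eventually_le_const zero_lt_one] with n hn
  simpa using hn

/-- The last time `t + 1 ≤ T`, where `T = (1 + δ) log_ν log_d n`, satisfies `ν ^ t ≥ C log n`. -/
theorem eventually_exists_time {ν : ℕ} (hν : 2 ≤ ν) {d : ℝ} (hd : 1 < d) {δ : ℝ} (hδ : 0 < δ)
    (C : ℝ) : ∃ a : ℝ, ∀ᶠ u : ℝ in atTop, ∃ t : ℕ,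
      ((t + 1 : ℕ) : ℝ) ≤ (1 + δ) * Real.log (u / Real.log d) / Real.log ν ∧
      (t : ℝ) ≤ a * Real.log u ∧ C * u ≤ (ν : ℝ) ^ t := by
  have hν' : (2 : ℝ) ≤ ν := by exact_mod_cast hν
  have hlogν : 0 < Real.log ν := Real.log_pos (by linarith)
  have hlogd : 0 < Real.log d := Real.log_pos hd
  have hdiv : Tendsto (fun u : ℝ => u / Real.log d) atTop atTop :=
    tendsto_id.atTop_div_const hlogd
  have hT : Tendsto (fun u : ℝ => (1 + δ) * Real.log (u / Real.log d) / Real.log ν) atTop atTop :=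
    ((Real.tendsto_log_atTop.comp hdiv).const_mul_atTop (by linarith)).atTop_div_const hlogν
  refine ⟨(1 + δ) * (1 + |Real.log (Real.log d)|) / Real.log ν, ?_⟩
  filter_upwards [hT.eventually_ge_atTop 1, Real.tendsto_log_atTop.eventually_ge_atTop 1,
    hdiv.eventually (eventually_mul_le_rpow hδ (C * Real.log d * ν ^ 2)), eventually_gt_atTop 0]
    with u hu hlog hpow hu0
  set T : ℝ := (1 + δ) * Real.log (u / Real.log d) / Real.log ν with hTdef
  have hfloor : 1 ≤ ⌊T⌋₊ := Nat.le_floor (by simpa using hu)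
  -- Rounding down and the shift from `t + 1` to `t` cost at most a factor `ν ^ 2`, which the
  -- surplus `δ` in `ν ^ T = (u / log d) ^ (1 + δ)` absorbs.
  refine ⟨⌊T⌋₊ - 1, ?_, ?_, ?_⟩
  · rw [Nat.sub_add_cancel hfloor]
    exact Nat.floor_le (by linarith)
  · have h1 : ((⌊T⌋₊ - 1 : ℕ) : ℝ) ≤ T :=
      (Nat.cast_le.2 (Nat.sub_le _ _)).trans (Nat.floor_le (by linarith))
    refine h1.trans ?_
    rw [hTdef, div_mul_eq_mul_div, Real.log_div hu0.ne' hlogd.ne']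
    gcongr ?_ / _
    rw [mul_assoc]
    refine mul_le_mul_of_nonneg_left ?_ (by linarith)
    have := neg_abs_le (Real.log (Real.log d))
    nlinarith [abs_nonneg (Real.log (Real.log d))]
  · have h1 : T - 2 ≤ ((⌊T⌋₊ - 1 : ℕ) : ℝ) := by
      rw [Nat.cast_sub hfloor]
      have := (Nat.lt_floor_add_one T).le
      push_cast
      linarith
    have h2 : (ν : ℝ) ^ T = (u / Real.log d) ^ (1 + δ) := by
      rw [Real.rpow_def_of_pos (by linarith), Real.rpow_def_of_pos (div_pos hu0 hlogd), hTdef]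
      congr 1
      field_simp
    have h3 : (ν : ℝ) ^ T ≤ (ν : ℝ) ^ (⌊T⌋₊ - 1) * (ν : ℝ) ^ 2 := by
      rw [← pow_add, ← Real.rpow_natCast]
      refine Real.rpow_le_rpow_of_exponent_le (by linarith) ?_
      push_cast
      linarith
    have h4 : C * u * (ν : ℝ) ^ 2 ≤ (ν : ℝ) ^ (⌊T⌋₊ - 1) * (ν : ℝ) ^ 2 := by
      refine le_trans (le_of_eq ?_) (hpow.trans (h2 ▸ h3))
      field_simp
    exact le_of_mul_le_mul_right h4 (by positivity)

theorem two_mul_sqrt_mul_one_sub_lt_one {p : ℝ} (h₁ : p < 1 / 2) :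
    2 * Real.sqrt (p * (1 - p)) < 1 := by
  have : Real.sqrt (p * (1 - p)) < 1 / 2 := by
    rw [Real.sqrt_lt' (by norm_num)]
    nlinarith [mul_pos (sub_pos.2 h₁) (sub_pos.2 h₁)]
  linarith

theorem pow_le_exp_neg {β : ℝ} (hβ : 0 < β) {k : ℕ} {y : ℝ} (h : y ≤ -Real.log β * k) :
    β ^ k ≤ Real.exp (-y) := by
  calc β ^ k = Real.exp (k * Real.log β) := by rw [Real.exp_nat_mul, Real.exp_log hβ]
    _ ≤ Real.exp (-y) := Real.exp_le_exp.2 (by linarith)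

theorem four_mul_exp_le_rpow {x : ℝ} (hx : 256 ≤ x) :
    4 * Real.exp (-(Real.log x / 2)) ≤ x ^ (-(1 / 4) : ℝ) := by
  have hlog : Real.log 4 ≤ Real.log x / 4 := by
    have : Real.log ((4 : ℝ) ^ 4) ≤ Real.log x :=
      Real.log_le_log (by norm_num) (by norm_num; linarith)
    rw [Real.log_pow] at this
    push_cast at this
    linarith
  rw [Real.rpow_def_of_pos (by linarith)]
  calc 4 * Real.exp (-(Real.log x / 2))
      = Real.exp (Real.log 4 + -(Real.log x / 2)) := by
        rw [Real.exp_add, Real.exp_log (by norm_num)]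
    _ ≤ _ := Real.exp_le_exp.2 (by linarith)

end Asymptotics

end MajorityPolling

/-! ### Choice of constants and conclusion -/

open Filter in
theorem theorem4
    (ε : ℝ) (hε : 0 < ε)
    (ε' : ℝ) (hε' : 0 < ε')
    (d : ℕ) (hd : 5 ≤ d) (hodd : Odd d)
    (α : unitInterval) (hα₀ : 0 < (α : ℝ)) (hα₁ : (α : ℝ) < 1 / 2)
    (ν : ℕ) (hν : ν = (d - 1) / 2)
    (β : ℝ) (hβ : β < 1)
    (hcond : ((1 + 1 / Real.sqrt (2 * (ν : ℝ))) * 2) ^ (1 / ((ν : ℝ) - 1))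
      * (4 * (α : ℝ) * (1 - (α : ℝ))) < β)
    (A : ℝ) (hA : A = (1 + ε') / (Real.logb d ((d : ℝ) - 1) - Real.logb d 2)) :
    ∃ γ : ℝ, 0 < γ ∧ ∃ n₀ : ℕ, ∀ n : ℕ, n₀ ≤ n →
      ∀ c : ℝ, 2 + ε < c → ∀ p : unitInterval, (p : ℝ) = c * Real.log n / n →
        1 - (n : ℝ) ^ (-γ) ≤
          (MajorityPolling.trialLaw n d p α).real
            (MajorityPolling.majorityConsensusBy d (A * Real.logb d (Real.logb d n))) := by
  obtain rfl : d = 2 * ν + 1 := by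
    obtain ⟨k, rfl⟩ := hodd
    lia
  have hν2 : 2 ≤ ν := by lia
  have hν2' : (2 : ℝ) ≤ ν := by exact_mod_cast hν2
  have hβ0 : 0 < β := by
    refine lt_of_le_of_lt ?_ hcond
    exact mul_nonneg (Real.rpow_nonneg (by positivity) _)
      (mul_nonneg (by linarith) (by linarith))
  have hlogβ : 0 < -Real.log β := neg_pos.2 (Real.log_neg hβ0 hβ)
  set D : ℝ := ((2 * ν + 1 : ℕ) : ℝ) with hD
  have hD' : D = 2 * ν + 1 := by rw [hD]; push_cast; ring
  have hD1 : 1 < D := by rw [hD']; linarith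
  have hlogD : 0 < Real.log D := Real.log_pos hD1
  have hlogν : 0 < Real.log ν := Real.log_pos (by linarith)
  -- As `(d - 1) / 2 = ν`, the denominator of `A` is `log_d ν`, and the time limit becomes `(1 + ε')
  -- log_ν log_d n`.
  have hT : ∀ n : ℕ, A * Real.logb D (Real.logb D n) =
      (1 + ε') * Real.log (Real.log n / Real.log D) / Real.log ν := by
    intro n
    have h1 : Real.logb D (D - 1) - Real.logb D 2 = Real.log ν / Real.log D := by
      rw [← Real.logb_div (by linarith) (by norm_num), hD', add_sub_cancel_right,
        mul_div_cancel_left₀ _ (by norm_num : (2 : ℝ) ≠ 0), ← hD']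
      rfl
    rw [hA, h1, Real.logb, Real.logb]
    field_simp
  have hlog : Tendsto (fun n : ℕ => Real.log n) atTop atTop :=
    Real.tendsto_log_atTop.comp tendsto_natCast_atTop_atTop
  -- With this constant `β ^ ν ^ t ≤ exp (-2u) = n⁻²`, enough for a union over `n` vertices.
  obtain ⟨a, ha⟩ := MajorityPolling.eventually_exists_time hν2 hD1 hε' (2 / -Real.log β)
  have hev : ∀ᶠ n : ℕ in atTop, _ := (hlog.eventually ha).and
    ((hlog.eventually (MajorityPolling.eventually_pow_le_sqrt a (40 * D) (by linarith))).and
      ((MajorityPolling.eventually_natCast_mul_pow_le_one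
        (q := 2 * Real.sqrt (α * (1 - α))) (by positivity)
        (MajorityPolling.two_mul_sqrt_mul_one_sub_lt_one hα₁)).and
        ((hlog.eventually_ge_atTop (20 * D)).and ((eventually_ge_atTop 256).and
          (tendsto_natCast_atTop_atTop.eventually_ge_atTop (D ^ 2))))))
  obtain ⟨n₀, hn₀⟩ := eventually_atTop.1 hev
  -- Each of the four error terms will be at most `s = n ^ (-1/2)`, and `4s ≤ n ^ (-1/4)` because `n
  -- ≥ 256 = 4 ^ 4`.
  refine ⟨1 / 4, by norm_num, n₀, fun n hn c hc p hp => ?_⟩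
  obtain ⟨⟨t, ht, hta, htν⟩, hpow, hmaj, hlogn, hn256, hnD⟩ := hn₀ n hn
  set u : ℝ := Real.log n with hu
  have hn256' : (256 : ℝ) ≤ n := by exact_mod_cast hn256
  have hnpos : (0 : ℝ) < n := by linarith
  have hu0 : 0 < u := Real.log_pos (by linarith)
  have hexp : Real.exp u = n := Real.exp_log hnpos
  have hnp : (n : ℝ) * p = c * u := by rw [hp]; field_simp
  have hnp2 : 2 * u ≤ n * p := by rw [hnp]; nlinarith
  have key := MajorityPolling.one_sub_trialLaw_real_majorityConsensusBy_le (n := n) hν2 (p := p)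
    (α := α) (by lia) hα₁.le (by linarith) (T := A * Real.logb D (Real.logb D n)) (t := t)
    (by rw [hT]; exact ht) (c := β ^ ν ^ t) (by positivity)
    (MajorityPolling.iterate_binomialTail_le hν2 hα₀.le hα₁.le hβ.le hcond.le t)
  set s : ℝ := Real.exp (-(u / 2)) with hs
  have hsn : s * n = Real.exp (u / 2) := by
    rw [hs, ← hexp, ← Real.exp_add]
    ring_nf
  have hss : s * s = 1 / n := by
    rw [hs, ← Real.exp_add, ← hexp, one_div, ← Real.exp_neg]
    ring_nf
  have hs1 : s ≤ 1 := by rw [hs]; exact Real.exp_le_one_iff.2 (by linarith)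
  have hs0 : 0 < s := Real.exp_pos _
  have b₀ : (2 * Real.sqrt (α * (1 - α))) ^ n ≤ s := by
    have h1 : (2 * Real.sqrt (α * (1 - α))) ^ n ≤ 1 / n := by
      rw [le_div_iff₀ hnpos, mul_comm]
      exact hmaj
    refine h1.trans ?_
    rw [← hss]
    nlinarith
  -- From `np ≥ 2u` the exponent is at most `-3u / 2`, which beats the factor `n` by exactly `s`.
  have b₁ : n * Real.exp (-(3 / 4) * (n * p)) ≤ s := by
    rw [← hexp, ← Real.exp_add, hs, Real.exp_le_exp, hexp]
    linarith
  have b₂ : n * (((6 * (t + 2) : ℕ) : ℝ) * (6 * (t + 2) : ℕ) ^ (6 * (t + 2)) *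
      (40 * D) ^ (6 * (t + 2) + 1) / (n : ℝ) ^ 2) ≤ s := by
    have h1 := hpow t hta
    rw [← hsn] at h1
    generalize ((6 * (t + 2) : ℕ) : ℝ) * (6 * (t + 2) : ℕ) ^ (6 * (t + 2)) *
      (40 * D) ^ (6 * (t + 2) + 1) = X at h1
    calc n * (X / (n : ℝ) ^ 2) = X / n := by field_simp
      _ ≤ s := (div_le_iff₀ hnpos).2 h1
  have b₃ : n * (D * β ^ ν ^ t) ≤ s := by
    have h1 : β ^ ν ^ t ≤ Real.exp (-(2 * u)) := by
      refine MajorityPolling.pow_le_exp_neg hβ0 ?_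
      rw [div_mul_eq_mul_div, div_le_iff₀ hlogβ] at htν
      push_cast
      linarith
    have h2 : Real.exp (-(2 * u)) = s * s * (s * s) := by
      rw [hs, ← Real.exp_add, ← Real.exp_add]
      ring_nf
    have h3 : D * s ≤ 1 := by
      have : (D * s) ^ 2 ≤ 1 := by
        rw [mul_pow, pow_two s, hss, mul_one_div]
        exact (div_le_one hnpos).2 hnD
      exact (sq_le_one_iff₀ (by positivity)).1 this
    calc n * (D * β ^ ν ^ t) ≤ n * (D * Real.exp (-(2 * u))) := by gcongr
      _ = (n * (s * s)) * (D * s) * s := by rw [h2]; ring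
      _ = (D * s) * s := by rw [hss, mul_one_div_cancel hnpos.ne', one_mul]
      _ ≤ s := mul_le_of_le_one_left hs0.le h3
  have hfin : 4 * s ≤ (n : ℝ) ^ (-(1 / 4) : ℝ) := MajorityPolling.four_mul_exp_le_rpow hn256'
  rw [← hD] at key
  linarith only [key, b₀, b₁, b₂, b₃, hfin]
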